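/- Let $d$ and $n$ be positive integers and let $\lambda>0$ be real. There are $n$ bins, and balls arrive in a Poisson process of rate $\lambda n$. On arrival each ball chooses a list of $d$ bins independently and uniformly at random, with replacement, and is placed in the first least-loaded bin in its list. All balls, including those present initially, have independent exponential lifetimes with mean $1$, after which they disappear. The initial load vector, the arrival process, the choices and the lifetimes are independent. For $t\ge 0$ let $X_t=(X_t(1),\dots,X_t(n))\in(\mathbb{Z}_{\ge0})^n$ be the load vector at time $t$, where $X_t(j)$ is the number of balls in bin $j$ at time $t$, and let $|X_t|=\sum_{j}X_t(j)$. For probability distributions $\mu_1,\mu_2$ on $(\mathbb{Z}_{\ge0})^n$ put $$d_{\mathrm{TV}}(\mu_1,\mu_2)=\inf \Pr(X\ne Y),\qquad d_{\mathrm W}(\mu_1,\mu_2)=\inf \mathbf{E}\,\|X-Y\|_1,$$ where both infima are over all couplings of $X\sim\mu_1$ and $Y\sim\mu_2$, and write $\mathcal L(X)$ for the law of $X$. Theorem 1.1. There is a unique stationary distribution $\mathbf{\Pi}$ for the load vector, that is, a unique probability distribution $\mathbf\Pi$ on $(\mathbb{Z}_{\ge0})^n$ such that $\mathcal L(X_0)=\mathbf\Pi$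 implies $\mathcal L(X_t)=\mathbf\Pi$ for all $t\ge 0$. For every initial distribution with $\mathbf{E}|X_0|<\infty$ and every $t\ge0$, $$d_{\mathrm{TV}}(\mathcal L(X_t),\mathbf\Pi)\le d_{\mathrm W}(\mathcal L(X_t),\mathbf\Pi)\le(\lambda n+\mathbf{E}|X_0|)\,e^{-t}.$$ -/

import Mathlib

open MeasureTheory ProbabilityTheory
open scoped ENNReal

noncomputable section

namespace BallsBins

/-! ### The dynamics, as a deterministic function of the random input -/

/-- The randomness that drives a system of `n` bins with `d` choices per arriving ball.
Arriving balls are numbered `0, 1, 2, …` in order of arrival. -/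
abbrev Input (d n : ℕ) : Type :=
  (Fin n → ℕ) × (Fin n × ℕ → ℝ) × (ℕ → ℝ) × (ℕ → Fin d → Fin n) × (ℕ → ℝ)

namespace Input

variable {d n : ℕ}

/-- The number of balls initially present in each bin. -/
abbrev init (u : Input d n) : Fin n → ℕ := u.1

/-- The lifetimes of the initial balls: ball number `i < init j` of bin `j` dies at time
`initLife (j, i)`. -/
abbrev initLife (u : Input d n) : Fin n × ℕ → ℝ := u.2.1

/-- The waiting times between consecutive arrivals (for ball `0`: from time `0`). -/
abbrev gap (u : Input d n) : ℕ → ℝ := u.2.2.1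

/-- The list of `d` bins (repetitions allowed) chosen by each arriving ball. -/
abbrev choice (u : Input d n) : ℕ → Fin d → Fin n := u.2.2.2.1

/-- The lifetimes of the arriving balls. -/
abbrev life (u : Input d n) : ℕ → ℝ := u.2.2.2.2

/-- The arrival time of ball `k`. -/
def arrival (u : Input d n) (k : ℕ) : ℝ := ∑ i ∈ Finset.range (k + 1), u.gap i

/-- The number of initial balls of bin `j` that are still alive at time `t`. -/
def initAlive (u : Input d n) (t : ℝ) (j : Fin n) : ℕ :=
  ((Finset.range (u.init j)).filter fun i => t < u.initLife (j, i)).card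

end Input

theorem leastLoaded_nonempty {d n : ℕ} [NeZero d] (c : Fin d → Fin n) (x : Fin n → ℕ) :
    (Finset.univ.filter fun i : Fin d => ∀ i', x (c i) ≤ x (c i')).Nonempty := by
  obtain ⟨i, hi⟩ := Finite.exists_min fun i => x (c i)
  exact ⟨i, by simpa using hi⟩

/-- The first least loaded bin in the list `c` of chosen bins, when the loads are `x`. -/
def leastLoaded {d n : ℕ} [NeZero d] (c : Fin d → Fin n) (x : Fin n → ℕ) : Fin n :=
  c ((Finset.univ.filter fun i : Fin d => ∀ i', x (c i) ≤ x (c i')).min'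
    (leastLoaded_nonempty c x))

namespace Input

variable {d n : ℕ} [NeZero d]

/-- The bin in which ball `k` is placed: the first least loaded one among its choices, where
the loads are those formed, at the arrival time of ball `k`, by the initial balls and the balls
`m < k` that are still alive. -/
def bin (u : Input d n) (k : ℕ) : Fin n :=
  leastLoaded (u.choice k) fun j =>
    u.initAlive (u.arrival k) j +
      (Finset.univ.filter fun m : Fin k =>
        u.bin m.1 = j ∧ u.arrival k < u.arrival m.1 + u.life m.1).card
termination_by k
decreasing_by all_goals exact Fin.isLt _

/-- The load of bin `j` at time `t`: the number of initial balls of that bin that are still alive,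
plus the number of balls that have arrived by time `t`, were placed in bin `j` and are
still alive. -/
def load (u : Input d n) (t : ℝ) (j : Fin n) : ℕ :=
  u.initAlive t j +
    Set.ncard {k : ℕ | u.arrival k ≤ t ∧ u.bin k = j ∧ t < u.arrival k + u.life k}

end Input

/-! ### The law of the process -/

/-- The law of the input when the initial load vector has law `ν`: the initial load vector, the
lifetimes, the arrival process and the choices are independent, lifetimes are exponential with
mean `1`, arrivals form a Poisson process of rate `lam * n` (the waiting times are i.i.d.
exponential), and each ball chooses a uniform random element of `(Fin n)^d`. -/
def inputLaw (lam : ℝ) (d n : ℕ) (ν : Measure (Fin n → ℕ)) : Measure (Input d n) :=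
  ν.prod <|
    (Measure.infinitePi fun _ : Fin n × ℕ => expMeasure 1).prod <|
      (Measure.infinitePi fun _ : ℕ => expMeasure (lam * n)).prod <|
        (Measure.infinitePi fun _ : ℕ => uniformOn (Set.univ : Set (Fin d → Fin n))).prod <|
          Measure.infinitePi fun _ : ℕ => expMeasure 1

/-- `X` is (almost surely) the load vector process of a balls-and-bins system, with arrival
rate `lam * n` and `d` choices, that lives on the probability space `(Ω, P)`. -/
def IsLoadProcess (lam : ℝ) (d n : ℕ) [NeZero d] {Ω : Type*} [MeasurableSpace Ω] (P : Measure Ω)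
    (X : ℝ → Ω → Fin n → ℕ) : Prop :=
  ∃ U : Ω → Input d n, HasLaw U (inputLaw lam d n (P.map (X 0))) P ∧
    ∀ᵐ ω ∂P, ∀ t : ℝ, 0 ≤ t → X t ω = (U ω).load t

/-- `π` is a stationary distribution for the load vector: if the initial load vector has law `π`,
then so has the load vector at each time `t ≥ 0`. -/
def IsStationary (lam : ℝ) (d n : ℕ) [NeZero d] (π : Measure (Fin n → ℕ)) : Prop :=
  IsProbabilityMeasure π ∧
    ∀ t : ℝ, 0 ≤ t → HasLaw (fun u : Input d n => u.load t) π (inputLaw lam d n π)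

/-! ### Distances between laws of load vectors -/

/-- The total number of balls. -/
def total {n : ℕ} (x : Fin n → ℕ) : ℕ := ∑ j, x j

/-- The distance `‖x - y‖₁`. -/
def l1Dist {n : ℕ} (x y : Fin n → ℕ) : ℕ := ∑ j, ((x j : ℤ) - (y j : ℤ)).natAbs

/-- `γ` is a coupling of `μ₁` and `μ₂`. -/
def IsCoupling {n : ℕ} (μ₁ μ₂ : Measure (Fin n → ℕ))
    (γ : Measure ((Fin n → ℕ) × (Fin n → ℕ))) : Prop :=
  γ.map Prod.fst = μ₁ ∧ γ.map Prod.snd = μ₂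

/-- The total variation distance: the infimum of `Pr (X ≠ Y)` over all couplings. -/
def dTV {n : ℕ} (μ₁ μ₂ : Measure (Fin n → ℕ)) : ℝ≥0∞ :=
  ⨅ (γ : Measure ((Fin n → ℕ) × (Fin n → ℕ))) (_ : IsCoupling μ₁ μ₂ γ), γ {z | z.1 ≠ z.2}

/-- The Wasserstein distance: the infimum of `E ‖X - Y‖₁` over all couplings. -/
def dW {n : ℕ} (μ₁ μ₂ : Measure (Fin n → ℕ)) : ℝ≥0∞ :=
  ⨅ (γ : Measure ((Fin n → ℕ) × (Fin n → ℕ))) (_ : IsCoupling μ₁ μ₂ γ),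
    ∫⁻ z, (l1Dist z.1 z.2 : ℝ≥0∞) ∂γ

end BallsBins

end

/-! ### Infinite product measures: splitting families of independent variables. -/

section ProductMeasures

open Measure

/-! Two copies of the system are run with the same arrivals and choices, and with shared lifetimes.
Placing a ball in both copies never increases their l1 distance (`l1Dist_place_le`). Departures over
a time `s` multiply its mean by `exp (-s)` (`lintegral_l1Dist_thin`), because balls are matched
within each bin and only the unmatched ones contribute. Hence the mean distance at time `t` is at
most `exp (-t)` times the initial one (`lintegral_l1Dist_loadAt_le`).

For the two copies to be matched afresh after each arrival, lifetimes must be redrawn there. The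
proof therefore works with a Markovian model, `loadAt`, in which all balls receive fresh lifetimes
after every arrival. By memorylessness it has the same law at each time as the model with one
lifetime per ball: `lintegral_loadAfter` shows this for fixed waiting times and choices, and
`hasLaw_load` in general. Facts about `loadAt` come from conditioning on the first arrival;
`le_of_first_step` compares bounded subsolutions of the resulting equation with supersolutions. It
gives the contraction, the Chapman–Kolmogorov equation `evol_add` and the bound on the mean number
of balls `evol_total_le`.

Started from no balls, the mean number of balls never exceeds `Λ = lam * n`, so by contraction the
laws at large times are close to one another. The pointwise lower limit of their masses defines
`limitLaw`. Fatou's lemma and the mean bound (which gives tightness) show that it is a stationary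
probability measure with mean total at most `Λ`. Two stationary laws coincide because the system
forgets its initial state; truncating the distance at `1` makes this work without a finite mean.
Finally, independent initial states followed by shared noise give a coupling whose mean distance is
at most `exp (-t)` times the sum of the two mean totals (`dW_lawAt_le`). Total variation is
dominated since distinct integer vectors are at distance at least `1`. -/

/-- Two independent families of independent random variables form one such family. -/
theorem infinitePi_map_sumElim {ι κ X : Type*} [MeasurableSpace X] (μ : Measure X)
    [IsProbabilityMeasure μ] :
    ((infinitePi fun _ : ι => μ).prod (infinitePi fun _ : κ => μ)).map
      (fun p => Sum.elim p.1 p.2) = infinitePi fun _ : ι ⊕ κ => μ := by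
  classical
  have hm : Measurable fun p : (ι → X) × (κ → X) => Sum.elim p.1 p.2 := by
    refine measurable_pi_iff.2 ?_
    rintro (i | i) <;> simp <;> fun_prop
  refine eq_infinitePi _ fun s t ht => ?_
  rw [map_apply hm (.pi s.countable_toSet fun _ _ => ht _)]
  have : (fun p : (ι → X) × (κ → X) => Sum.elim p.1 p.2) ⁻¹' ((s : Set (ι ⊕ κ)).pi t) =
      ((s.toLeft : Set ι).pi fun i => t (.inl i)) ×ˢ ((s.toRight : Set κ).pi fun i => t (.inr i)) := by
    ext p
    simp [Set.mem_pi, Sum.forall]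
  rw [this, prod_prod, infinitePi_pi _ fun i _ => ht _, infinitePi_pi _ fun i _ => ht _]
  conv_rhs => rw [← Finset.toLeft_disjSum_toRight (u := s), Finset.prod_disjSum]

/-- The sequence `a, w 0, w 1, …`. -/
def seqCons {X : Type*} (a : X) (w : ℕ → X) : ℕ → X
  | 0 => a
  | k + 1 => w k

@[simp] theorem seqCons_zero {X : Type*} (a : X) (w : ℕ → X) : seqCons a w 0 = a := rfl

@[simp] theorem seqCons_succ {X : Type*} (a : X) (w : ℕ → X) (k : ℕ) :
    seqCons a w (k + 1) = w k := rfl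

theorem measurable_seqCons {X : Type*} [MeasurableSpace X] :
    Measurable fun p : X × (ℕ → X) => seqCons p.1 p.2 := by
  refine measurable_pi_iff.2 ?_
  rintro (_ | i) <;> simp only [seqCons_zero, seqCons_succ] <;> fun_prop

/-- A sequence of i.i.d. random variables, split into its first element and the rest. -/
theorem infinitePi_map_seqCons {X : Type*} [MeasurableSpace X] (μ : Measure X)
    [IsProbabilityMeasure μ] :
    (μ.prod (infinitePi fun _ : ℕ => μ)).map
      (fun p => seqCons p.1 p.2) = infinitePi fun _ : ℕ => μ := by
  have hm := measurable_seqCons (X := X)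
  refine eq_infinitePi _ fun s t ht => ?_
  rw [map_apply hm (.pi s.countable_toSet fun _ _ => ht _)]
  have : (fun p : X × (ℕ → X) => seqCons p.1 p.2) ⁻¹' ((s : Set ℕ).pi t) =
      (if 0 ∈ s then t 0 else Set.univ) ×ˢ
        (((s.preimage Nat.succ (Nat.succ_injective.injOn)) : Set ℕ).pi fun i => t (i + 1)) := by
    ext p
    simp only [Set.mem_preimage, Set.mem_pi, Set.mem_prod]
    constructor
    · intro h
      refine ⟨?_, fun i hi => h (i + 1) (by simpa using hi)⟩
      split_ifs with h0
      · exact h 0 h0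
      · trivial
    · rintro ⟨h0, h1⟩ (_ | i) hi
      · rw [if_pos (by simpa using hi)] at h0
        exact h0
      · exact h1 i (by simpa using hi)
  rw [this, prod_prod, infinitePi_pi _ fun i _ => ht _]
  by_cases h0 : 0 ∈ s
  · rw [if_pos h0, ← Finset.mul_prod_erase s (fun i => μ (t i)) h0]
    congr 1
    refine Finset.prod_bij' (fun i _ => i + 1) (fun i _ => i - 1) ?_ ?_ ?_ ?_ ?_ <;> simp
    · intro a h1 h2; rw [Nat.sub_add_cancel (by omega)]; exact h2
    · intro a h1 h2; omega
  · rw [if_neg h0, measure_univ, one_mul]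
    have hpos : ∀ i ∈ s, i - 1 + 1 = i := fun i hi =>
      Nat.sub_add_cancel (Nat.one_le_iff_ne_zero.2 fun h => h0 (h ▸ hi))
    exact Finset.prod_bij' (fun i _ => i + 1) (fun i _ => i - 1)
      (fun i hi => by simpa using hi) (fun i hi => by simpa [hpos i hi] using hi)
      (fun i _ => by simp) (fun i hi => hpos i hi) (fun i _ => rfl)

/-- A family of independent pairs is a pair of independent families. -/
theorem infinitePi_map_zip {ι X Y : Type*} [MeasurableSpace X] [MeasurableSpace Y]
    (μ : Measure X) (ν : Measure Y) [IsProbabilityMeasure μ] [IsProbabilityMeasure ν] :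
    ((infinitePi fun _ : ι => μ).prod (infinitePi fun _ : ι => ν)).map
      (fun p i => (p.1 i, p.2 i)) = infinitePi fun _ : ι => μ.prod ν := by
  classical
  refine eq_infinitePi _ fun s t ht => ?_
  rw [map_apply (by fun_prop) (.pi s.countable_toSet fun _ _ => ht _)]
  -- Only the finitely many coordinates in `s` matter, so after restriction the statement is the one
  -- for finite products.
  have h1 : (fun (p : (ι → X) × (ι → Y)) i => (p.1 i, p.2 i)) ⁻¹' ((s : Set ι).pi t) =
      (Prod.map (s.restrict : (ι → X) → (s → X)) (s.restrict : (ι → Y) → (s → Y))) ⁻¹'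
        ((MeasurableEquiv.arrowProdEquivProdArrow X Y s).symm ⁻¹'
          (Set.univ.pi fun i : s => t i)) := by
    ext p
    simp [Set.mem_pi, MeasurableEquiv.arrowProdEquivProdArrow, Equiv.arrowProdEquivProdArrow]
  have hmt : MeasurableSet (Set.univ.pi fun i : s => t i) := .univ_pi fun i => ht i
  rw [h1, ← map_apply (by fun_prop) (by measurability), ← map_prod_map _ _ (by fun_prop)
    (by fun_prop), infinitePi_map_restrict, infinitePi_map_restrict,
    ((measurePreserving_arrowProdEquivProdArrow X Y s (fun _ => μ) (fun _ => ν)).symm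
      (MeasurableEquiv.arrowProdEquivProdArrow X Y s)).measure_preimage hmt.nullMeasurableSet,
    pi_pi, Finset.prod_coe_sort s fun i => (μ.prod ν) (t i)]

theorem lintegral_infinitePi_succ {X : Type*} [MeasurableSpace X] (μ : Measure X)
    [IsProbabilityMeasure μ] {F : (ℕ → X) → ℝ≥0∞} (hF : Measurable F) :
    ∫⁻ w, F w ∂(infinitePi fun _ : ℕ => μ) =
      ∫⁻ a, ∫⁻ w, F (seqCons a w) ∂(infinitePi fun _ : ℕ => μ) ∂μ := by
  have hm := measurable_seqCons (X := X)
  conv_lhs => rw [← infinitePi_map_seqCons, lintegral_map hF hm]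
  exact lintegral_prod _ (hF.comp hm).aemeasurable

theorem lintegral_infinitePi_zip {ι X Y : Type*} [MeasurableSpace X] [MeasurableSpace Y]
    (μ : Measure X) (ν : Measure Y) [IsProbabilityMeasure μ] [IsProbabilityMeasure ν]
    {F : (ι → X × Y) → ℝ≥0∞} (hF : Measurable F) :
    ∫⁻ w, F w ∂(infinitePi fun _ : ι => μ.prod ν) =
      ∫⁻ a, ∫⁻ b, F (fun i => (a i, b i)) ∂(infinitePi fun _ : ι => ν)
        ∂(infinitePi fun _ : ι => μ) := by
  conv_lhs => rw [← infinitePi_map_zip, lintegral_map hF (by fun_prop)]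
  rw [lintegral_prod]
  exact (hF.comp (by fun_prop)).aemeasurable

theorem lintegral_infinitePi_sum {ι κ X : Type*} [MeasurableSpace X] (μ : Measure X)
    [IsProbabilityMeasure μ] {F : (ι ⊕ κ → X) → ℝ≥0∞} (hF : Measurable F) :
    ∫⁻ w, F w ∂(infinitePi fun _ : ι ⊕ κ => μ) =
      ∫⁻ a, ∫⁻ b, F (Sum.elim a b) ∂(infinitePi fun _ : κ => μ)
        ∂(infinitePi fun _ : ι => μ) := by
  have hm : Measurable fun p : (ι → X) × (κ → X) => Sum.elim p.1 p.2 := by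
    refine measurable_pi_iff.2 ?_
    rintro (i | i) <;> simp <;> fun_prop
  conv_lhs => rw [← infinitePi_map_sumElim, lintegral_map hF hm]
  exact lintegral_prod _ (hF.comp hm).aemeasurable

theorem ae_infinitePi_eval {ι X : Type*} [MeasurableSpace X] (μ : Measure X)
    [IsProbabilityMeasure μ] [Countable ι] {p : X → Prop} (h : ∀ᵐ x ∂μ, p x) :
    ∀ᵐ w ∂(infinitePi fun _ : ι => μ), ∀ i, p (w i) :=
  ae_all_iff.2 fun i =>
    (measurePreserving_eval_infinitePi (fun _ : ι => μ) i).quasiMeasurePreserving.ae h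

end ProductMeasures

/-! ### Exponential distributions and memorylessness. -/

section Exponential

open Measure

variable {r : ℝ}

theorem expMeasure_eq (r : ℝ) : expMeasure r = volume.withDensity (exponentialPDF r) := rfl

theorem measurable_exponentialPDF (r : ℝ) : Measurable (exponentialPDF r) :=
  (measurable_exponentialPDFReal r).ennreal_ofReal

/-- The memoryless property. -/
theorem setLIntegral_expMeasure_Ioi (r : ℝ) {t : ℝ} (ht : 0 ≤ t) {h : ℝ → ℝ≥0∞}
    (hh : Measurable h) :
    ∫⁻ x in Set.Ioi t, h x ∂(expMeasure r) =
      ENNReal.ofReal (Real.exp (-(r * t))) * ∫⁻ x, h (t + x) ∂(expMeasure r) := by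
  have hm := measurable_exponentialPDF r
  -- The density at `t + x` is `exp (-(r * t))` times the density at `x`, for `x > 0`; translation
  -- invariance of Lebesgue measure does the rest.
  have hp : ∀ x, (Set.Ioi t).indicator (fun y => exponentialPDF r y * h y) (t + x) =
      (Set.Ioi 0).indicator (fun x => ENNReal.ofReal (Real.exp (-(r * t))) *
        (exponentialPDF r x * h (t + x))) x := by
    intro x
    by_cases hx : 0 < x
    · have h1 : t + x ∈ Set.Ioi t := by simpa using hx
      rw [Set.indicator_of_mem h1, Set.indicator_of_mem (show x ∈ Set.Ioi 0 from hx),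
        exponentialPDF_of_nonneg (by positivity), exponentialPDF_of_nonneg hx.le, ← mul_assoc,
        ← ENNReal.ofReal_mul (by positivity)]
      congr 2
      rw [mul_left_comm, ← Real.exp_add]
      ring_nf
    · have h1 : t + x ∉ Set.Ioi t := by simpa using hx
      rw [Set.indicator_of_notMem h1, Set.indicator_of_notMem (by simpa using hx)]
  have h0 : ∫⁻ x, exponentialPDF r x * h (t + x) =
      ∫⁻ x in Set.Ioi 0, exponentialPDF r x * h (t + x) := by
    rw [← lintegral_indicator measurableSet_Ioi]
    refine lintegral_congr_ae ?_
    filter_upwards [(Set.finite_singleton (0 : ℝ)).countable.ae_notMem volume] with x hx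
    rcases lt_or_gt_of_ne (show x ≠ 0 by simpa using hx) with h2 | h2
    · rw [exponentialPDF_of_neg h2, Set.indicator_of_notMem (by simpa using h2.le), zero_mul]
    · rw [Set.indicator_of_mem (show x ∈ Set.Ioi 0 from h2)]
  rw [expMeasure_eq, restrict_withDensity measurableSet_Ioi,
    lintegral_withDensity_eq_lintegral_mul _ hm hh,
    lintegral_withDensity_eq_lintegral_mul _ hm (by fun_prop)]
  simp only [Pi.mul_apply]
  rw [h0, ← lintegral_const_mul _ (by fun_prop), ← lintegral_indicator measurableSet_Ioi,
    ← lintegral_add_left_eq_self _ t]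
  simp_rw [hp]
  rw [lintegral_indicator measurableSet_Ioi]

theorem expMeasure_Ioi (hr : 0 < r) {t : ℝ} (ht : 0 ≤ t) :
    expMeasure r (Set.Ioi t) = ENNReal.ofReal (Real.exp (-(r * t))) := by
  have := isProbabilityMeasure_expMeasure hr
  simpa using setLIntegral_expMeasure_Ioi r ht (h := fun _ => 1) measurable_const

theorem expMeasure_ae_pos (hr : 0 < r) : ∀ᵐ x ∂(expMeasure r), 0 < x := by
  have := isProbabilityMeasure_expMeasure hr
  have h := expMeasure_Ioi hr le_rfl
  simp only [mul_zero, neg_zero, Real.exp_zero, ENNReal.ofReal_one] at h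
  exact (prob_compl_eq_zero_iff measurableSet_Ioi).2 h

theorem expMeasure_Iic_lt_one (hr : 0 < r) {t : ℝ} (ht : 0 ≤ t) :
    expMeasure r (Set.Iic t) < 1 := by
  have := isProbabilityMeasure_expMeasure hr
  rw [← Set.compl_Ioi, prob_compl_eq_one_sub measurableSet_Ioi, expMeasure_Ioi hr ht]
  exact ENNReal.sub_lt_self ENNReal.one_ne_top one_ne_zero
    (by simpa using Real.exp_pos _)

/-- Replacing the residual lifetime after time `α` by a fresh exponential time does not change
the law of an exponential lifetime. -/
theorem expMeasure_map_resample (hr : 0 < r) {α : ℝ} (hα : 0 ≤ α) :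
    ((expMeasure r).prod (expMeasure r)).map
      (fun p => if α < p.1 then α + p.2 else p.1) = expMeasure r := by
  have := isProbabilityMeasure_expMeasure hr
  have hm : Measurable fun p : ℝ × ℝ => if α < p.1 then α + p.2 else p.1 :=
    Measurable.ite (measurableSet_lt measurable_const measurable_fst) (by fun_prop) (by fun_prop)
  ext B hB
  rw [map_apply hm hB, ← lintegral_indicator_one (hm hB), lintegral_prod _
    ((measurable_one.indicator (hm hB)).aemeasurable), ← lintegral_add_compl _
    (measurableSet_Ioi (a := α)), ← lintegral_indicator_one hB,
    ← lintegral_add_compl (B.indicator 1) (measurableSet_Ioi (a := α))]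
  congr 1
  · rw [setLIntegral_expMeasure_Ioi r hα (measurable_one.indicator hB)]
    have : ∀ x ∈ Set.Ioi α, (∫⁻ y, ((fun p : ℝ × ℝ => if α < p.1 then α + p.2 else p.1) ⁻¹' B).indicator
        1 (x, y) ∂(expMeasure r)) = ∫⁻ x, B.indicator (1 : ℝ → ℝ≥0∞) (α + x) ∂(expMeasure r) := by
      intro x hx
      refine lintegral_congr fun y => ?_
      change B.indicator (1 : ℝ → ℝ≥0∞) (if α < x then α + y else x) = _
      rw [if_pos (show α < x from hx)]
    rw [setLIntegral_congr_fun measurableSet_Ioi this]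
    simp [expMeasure_Ioi hr hα, mul_comm]
  · refine setLIntegral_congr_fun measurableSet_Ioi.compl fun x hx => ?_
    have hx' : ¬ α < x := hx
    change ∫⁻ y, B.indicator (1 : ℝ → ℝ≥0∞) (if α < x then α + y else x) ∂(expMeasure r) = _
    simp [if_neg hx']

end Exponential

/-! ### Effect of a placement and of departures on the l1 distance. -/

noncomputable section

namespace BallsBins

variable {d n : ℕ}

/-! ### Placing a ball -/

/-- The load vector after a ball with list of choices `c` has been placed. -/
def place [NeZero d] (c : Fin d → Fin n) (x : Fin n → ℕ) : Fin n → ℕ :=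
  fun j => x j + if leastLoaded c x = j then 1 else 0

theorem exists_leastLoaded [NeZero d] (c : Fin d → Fin n) (x : Fin n → ℕ) :
    ∃ i, leastLoaded c x = c i ∧ (∀ i', x (c i) ≤ x (c i')) ∧
      ∀ i', (∀ k, x (c i') ≤ x (c k)) → i ≤ i' := by
  refine ⟨_, rfl, ?_, fun i' h => Finset.min'_le _ _ (by simpa using h)⟩
  have := Finset.min'_mem _ (leastLoaded_nonempty c x)
  rw [Finset.mem_filter] at this
  exact this.2

/-- If both balls enter the same bin, no difference changes. Otherwise let `a` and `b` be the bins
selected by `x` and `y`. Then `x a - y a < x b - y b`; the placements raise the smaller of these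
integers by one and lower the larger by one, which cannot increase the sum of absolute values. -/
theorem l1Dist_place_le [NeZero d] (c : Fin d → Fin n) (x y : Fin n → ℕ) :
    l1Dist (place c x) (place c y) ≤ l1Dist x y := by
  unfold l1Dist place
  obtain ⟨i, hi, hi1, hi2⟩ := exists_leastLoaded c x
  obtain ⟨k, hk, hk1, hk2⟩ := exists_leastLoaded c y
  by_cases h : leastLoaded c x = leastLoaded c y
  · refine Finset.sum_le_sum fun j _ => ?_
    rw [h]
    split_ifs <;> omega
  · have hlt : x (leastLoaded c x) + y (leastLoaded c y) <
        x (leastLoaded c y) + y (leastLoaded c x) := by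
      -- Without strictness, both selected bins are least loaded for both vectors, and the
      -- first-in-the-list rule forces the same index. This is where consistent tie-breaking is
      -- needed.
      by_contra hcon
      have h1 := hi1 k
      have h2 := hk1 i
      rw [← hi, ← hk] at h1 h2
      refine h ?_
      rw [hi, hk]
      congr 1
      refine le_antisymm (hi2 k fun m => ?_) (hk2 i fun m => ?_)
      · have := hi1 m; rw [← hi] at this; rw [← hk]; omega
      · have := hk1 m; rw [← hk] at this; rw [← hi]; omega
    have hmem : leastLoaded c y ∈ Finset.univ.erase (leastLoaded c x) :=
      Finset.mem_erase.2 ⟨fun e => h e.symm, Finset.mem_univ _⟩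
    rw [← Finset.add_sum_erase _ _ (Finset.mem_univ (leastLoaded c x)),
      ← Finset.add_sum_erase _ _ hmem,
      ← Finset.add_sum_erase Finset.univ (fun j => ((x j : ℤ) - y j).natAbs)
        (Finset.mem_univ (leastLoaded c x)),
      ← Finset.add_sum_erase _ (fun j => ((x j : ℤ) - y j).natAbs) hmem, ← add_assoc, ← add_assoc]
    refine add_le_add ?_ (Finset.sum_le_sum fun j hj => ?_)
    · rw [if_pos rfl, if_pos rfl, if_neg h, if_neg fun e => h e.symm]
      omega
    · simp only [Finset.mem_erase] at hj
      rw [if_neg fun e => hj.2.1 e.symm, if_neg fun e => hj.1 e.symm]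
      simp

theorem total_place [NeZero d] (c : Fin d → Fin n) (x : Fin n → ℕ) :
    total (place c x) = total x + 1 := by
  simp [total, place, Finset.sum_add_distrib]

theorem l1Dist_zero_right (x : Fin n → ℕ) : l1Dist x 0 = total x := by
  simp [l1Dist, total]

theorem l1Dist_comm (x y : Fin n → ℕ) : l1Dist x y = l1Dist y x := by
  unfold l1Dist
  refine Finset.sum_congr rfl fun j _ => ?_
  omega

theorem l1Dist_le (x y : Fin n → ℕ) : l1Dist x y ≤ total x + total y := by
  unfold l1Dist total
  rw [← Finset.sum_add_distrib]
  refine Finset.sum_le_sum fun j _ => ?_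
  omega

theorem one_le_l1Dist {x y : Fin n → ℕ} (h : x ≠ y) : 1 ≤ l1Dist x y := by
  obtain ⟨j, hj⟩ := Function.ne_iff.1 h
  refine le_trans ?_ (Finset.single_le_sum (f := fun j => ((x j : ℤ) - y j).natAbs)
    (fun _ _ => Nat.zero_le _) (Finset.mem_univ j))
  show 1 ≤ ((x j : ℤ) - y j).natAbs
  omega

/-! ### Thinning -/

instance isProbabilityMeasure_expMeasure_one : IsProbabilityMeasure (expMeasure 1) :=
  isProbabilityMeasure_expMeasure one_pos

/-- The law of a family of independent exponential lifetimes with mean `1`. -/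
abbrev lifeLaw (ι : Type*) : Measure (ι → ℝ) := Measure.infinitePi fun _ => expMeasure 1

/-- The loads that remain of `x` after time `s`, if ball `i < x j` of bin `j` has lifetime
`ξ (j, i)`. -/
def thin (s : ℝ) (ξ : Fin n × ℕ → ℝ) (x : Fin n → ℕ) : Fin n → ℕ :=
  fun j => ((Finset.range (x j)).filter fun i => s < ξ (j, i)).card

theorem measurable_card_filter {α ι : Type*} [MeasurableSpace α] (J : Finset ι)
    {p : α → ι → Prop} [∀ a, DecidablePred (p a)] (hp : ∀ i ∈ J, MeasurableSet {a | p a i}) :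
    Measurable fun a => (J.filter (p a)).card := by
  simp_rw [Finset.card_filter]
  exact Finset.measurable_sum _ fun i hi => Measurable.ite (hp i hi) measurable_const
    measurable_const

theorem measurable_thin :
    Measurable fun p : ℝ × (Fin n × ℕ → ℝ) × (Fin n → ℕ) => thin p.1 p.2.1 p.2.2 := by
  have h : Measurable fun q : (ℝ × (Fin n × ℕ → ℝ)) × (Fin n → ℕ) => thin q.1.1 q.1.2 q.2 := by
    refine measurable_from_prod_countable_left fun x => measurable_pi_iff.2 fun j => ?_
    change Measurable fun q : ℝ × (Fin n × ℕ → ℝ) =>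
      ((Finset.range (x j)).filter fun i => q.1 < q.2 (j, i)).card
    exact measurable_card_filter _ fun i _ => measurableSet_lt (by fun_prop) (by fun_prop)
  exact h.comp (g := fun q : (ℝ × (Fin n × ℕ → ℝ)) × (Fin n → ℕ) => thin q.1.1 q.1.2 q.2)
    (f := fun p : ℝ × (Fin n × ℕ → ℝ) × (Fin n → ℕ) => ((p.1, p.2.1), p.2.2)) (by fun_prop)

theorem measurable_thin_comp {α : Type*} [MeasurableSpace α] {s : α → ℝ}
    {ξ : α → Fin n × ℕ → ℝ} {x : α → Fin n → ℕ} (hs : Measurable s) (hξ : Measurable ξ)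
    (hx : Measurable x) : Measurable fun a => thin (s a) (ξ a) (x a) :=
  measurable_thin.comp (hs.prodMk (hξ.prodMk hx))

theorem measurable_thin_right (s : ℝ) (x : Fin n → ℕ) :
    Measurable fun ξ : Fin n × ℕ → ℝ => thin s ξ x :=
  measurable_thin.comp (f := fun ξ => (s, ξ, x)) (by fun_prop)

/-- The number of survivors in each bin does not depend on how the balls are labelled. -/
theorem lintegral_survivors {ι : Type*} (J : Finset ι) (β : ι → Fin n) (r : ℝ)
    (f : (Fin n → ℕ) → ℝ≥0∞) :
    ∫⁻ ζ, f (fun j => (J.filter fun i => β i = j ∧ r < ζ i).card) ∂lifeLaw ι =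
      ∫⁻ ξ, f (thin r ξ fun j => (J.filter fun i => β i = j).card) ∂lifeLaw (Fin n × ℕ) := by
  classical
  set A : Fin n → Finset ι := fun j => J.filter fun i => β i = j with hA
  -- Both labellings are injections of one finite index type, so the lifetimes they select have the
  -- same law.
  let e₁ : (Σ j, Fin (A j).card) → Fin n × ℕ := fun p => (p.1, p.2)
  let e₂ : (Σ j, Fin (A j).card) → ι := fun p => ((A p.1).equivFin.symm p.2 : A p.1)
  have hβ : ∀ p, β (e₂ p) = p.1 := fun p =>
    (Finset.mem_filter.1 ((A p.1).equivFin.symm p.2).2).2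
  have h₁ : Function.Injective e₁ := by
    rintro ⟨j, i⟩ ⟨j', i'⟩ h
    simp only [e₁, Prod.mk.injEq] at h
    obtain ⟨rfl, h⟩ := h
    rw [Fin.ext h]
  have h₂ : Function.Injective e₂ := by
    rintro ⟨j, i⟩ ⟨j', i'⟩ h
    have hj : j = j' := (hβ ⟨j, i⟩).symm.trans ((congrArg β h).trans (hβ ⟨j', i'⟩))
    subst hj
    have hi : i = i' := (A j).equivFin.symm.injective (Subtype.ext h)
    rw [hi]
  let Φ : ((Σ j, Fin (A j).card) → ℝ) → ℝ≥0∞ := fun w =>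
    f fun j => (Finset.univ.filter fun i : Fin (A j).card => r < w ⟨j, i⟩).card
  have hΦ : Measurable Φ := (Measurable.of_discrete (f := f)).comp <|
    measurable_pi_iff.2 fun j => measurable_card_filter _ fun i _ =>
      measurableSet_lt (by fun_prop) (by fun_prop)
  have E₁ : ∀ ξ : Fin n × ℕ → ℝ, f (thin r ξ fun j => (A j).card) = Φ fun p => ξ (e₁ p) := by
    intro ξ
    refine congrArg f (funext fun j => ?_)
    simp only [thin, Finset.card_filter, e₁]
    exact Finset.sum_range fun i => if r < ξ (j, i) then 1 else 0
  have E₂ : ∀ ζ : ι → ℝ, f (fun j => (J.filter fun i => β i = j ∧ r < ζ i).card) =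
      Φ fun p => ζ (e₂ p) := by
    intro ζ
    refine congrArg f (funext fun j => ?_)
    rw [← Finset.filter_filter]
    simp only [Finset.card_filter, e₂]
    rw [← Finset.sum_coe_sort (A j) fun i => if r < ζ i then 1 else 0]
    exact ((A j).equivFin.symm.sum_comp fun i : A j => if r < ζ i then 1 else 0).symm
  refine (lintegral_congr E₂).trans (Eq.trans ?_ (lintegral_congr E₁).symm)
  rw [← lintegral_map (g := fun (ζ : ι → ℝ) p => ζ (e₂ p)) hΦ (by fun_prop),
    ← lintegral_map (g := fun (ξ : Fin n × ℕ → ℝ) p => ξ (e₁ p)) hΦ (by fun_prop),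
    Measure.map_infinitePi_infinitePi_of_inj h₁, Measure.map_infinitePi_infinitePi_of_inj h₂]

/-- Replaces the residual lifetimes after the times `α` by fresh ones. -/
def resample {ι : Type*} (α : ι → ℝ) (L L' : ι → ℝ) : ι → ℝ :=
  fun i => if α i < L i then α i + L' i else L i

theorem lintegral_resample {ι : Type*} {α : ι → ℝ} (hα : ∀ i, 0 ≤ α i) {F : (ι → ℝ) → ℝ≥0∞}
    (hF : Measurable F) :
    ∫⁻ L, F L ∂lifeLaw ι = ∫⁻ L, ∫⁻ L', F (resample α L L') ∂lifeLaw ι ∂lifeLaw ι := by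
  have hm : ∀ i, Measurable fun p : ℝ × ℝ => if α i < p.1 then α i + p.2 else p.1 := fun i =>
    Measurable.ite (measurableSet_lt measurable_const measurable_fst) (by fun_prop) (by fun_prop)
  have h : (Measure.infinitePi fun _ : ι => (expMeasure 1).prod (expMeasure 1)).map
      (fun w i => if α i < (w i).1 then α i + (w i).2 else (w i).1) = lifeLaw ι := by
    rw [Measure.infinitePi_map_pi _ hm]
    simp_rw [expMeasure_map_resample one_pos (hα _)]
  have hm' : Measurable fun (w : ι → ℝ × ℝ) i => if α i < (w i).1 then α i + (w i).2 else (w i).1 :=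
    measurable_pi_iff.2 fun i => (hm i).comp (measurable_pi_apply i)
  conv_lhs => rw [← h, lintegral_map hF hm']
  exact lintegral_infinitePi_zip _ _ (hF.comp hm')

/-- The memoryless property for the survivors of a finite set of balls, whose bins `β` may depend
on the part of the lifetimes up to the times `α`. -/
theorem lintegral_survivors_add {ι : Type*} [Countable ι] (J : Finset ι) {α : ι → ℝ}
    (hα : ∀ i, 0 ≤ α i) {r : ℝ} (hr : 0 ≤ r) {β : (ι → ℝ) → ι → Fin n}
    (hβm : ∀ i ∈ J, Measurable fun L => β L i)
    (hβ : ∀ L L', (∀ i, 0 < L' i) → ∀ i ∈ J, β (resample α L L') i = β L i)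
    (f : (Fin n → ℕ) → ℝ≥0∞) :
    ∫⁻ L, f (fun j => (J.filter fun i => β L i = j ∧ α i + r < L i).card) ∂lifeLaw ι =
      ∫⁻ L, ∫⁻ ξ, f (thin r ξ fun j => (J.filter fun i => β L i = j ∧ α i < L i).card)
        ∂lifeLaw (Fin n × ℕ) ∂lifeLaw ι := by
  have hF : Measurable fun L : ι → ℝ =>
      f (fun j => (J.filter fun i => β L i = j ∧ α i + r < L i).card) :=
    (Measurable.of_discrete (f := f)).comp <| measurable_pi_iff.2 fun j =>
      measurable_card_filter _ fun i hi => (hβm i hi (measurableSet_singleton j)).inter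
        (measurableSet_lt (f := fun _ => α i + r) measurable_const (measurable_pi_apply i))
  rw [lintegral_resample hα hF]
  -- For fixed `L`, the balls that outlive `α` and their bins are determined; `L'` supplies
  -- independent residual lifetimes, to which `lintegral_survivors` applies.
  refine lintegral_congr fun L => ?_
  have key := lintegral_survivors (J.filter fun i => α i < L i) (β L) r f
  simp only [Finset.filter_filter] at key
  have e : ∀ j, (J.filter fun i => β L i = j ∧ α i < L i) =
      J.filter fun i => α i < L i ∧ β L i = j := fun j => by simp only [and_comm]
  simp only [e]
  rw [← key]
  refine lintegral_congr_ae ?_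
  filter_upwards [ae_infinitePi_eval (ι := ι) _ (expMeasure_ae_pos one_pos)] with L' hL'
  refine congrArg f (funext fun j => congrArg Finset.card (Finset.filter_congr fun i hi => ?_))
  rw [hβ L L' hL' i hi]
  simp only [resample]
  split_ifs with h
  · simp [h]
  · constructor
    · rintro ⟨-, h1⟩; linarith
    · rintro ⟨h1, -⟩; exact absurd h1 h

/-- The semigroup property of departures: `lintegral_survivors_add` for the initial balls, all of
age `s`. Survivors may be relabelled from `0` within their bin. -/
theorem lintegral_thin_add {s t : ℝ} (hs : 0 ≤ s) (ht : 0 ≤ t) (x : Fin n → ℕ)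
    (f : (Fin n → ℕ) → ℝ≥0∞) :
    ∫⁻ ξ, f (thin (s + t) ξ x) ∂lifeLaw (Fin n × ℕ) =
      ∫⁻ ξ, ∫⁻ ξ', f (thin t ξ' (thin s ξ x)) ∂lifeLaw (Fin n × ℕ) ∂lifeLaw (Fin n × ℕ) := by
  classical
  have key := lintegral_survivors_add (ι := Fin n × ℕ)
    (Finset.univ.biUnion fun j => (Finset.range (x j)).image (Prod.mk j)) (α := fun _ => s)
    (fun _ => hs) ht (β := fun _ => Prod.fst) (fun _ _ => measurable_const) (fun _ _ _ _ _ => rfl) f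
  have e : ∀ (s : ℝ) (ξ : Fin n × ℕ → ℝ), (fun j => ((Finset.univ.biUnion fun j =>
      (Finset.range (x j)).image (Prod.mk j)).filter fun i => i.1 = j ∧ s < ξ i).card) =
      thin s ξ x := by
    intro s ξ
    funext j
    conv_rhs => rw [thin, ← Finset.card_image_of_injective _ (Prod.mk_right_injective j)]
    refine congrArg Finset.card ?_
    ext ⟨j', i⟩
    simp only [Finset.mem_filter, Finset.mem_biUnion, Finset.mem_univ, true_and, Finset.mem_image,
      Finset.mem_range, Prod.mk.injEq]
    constructor
    · rintro ⟨⟨_, i', hi', rfl, rfl⟩, rfl, h⟩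
      exact ⟨i', ⟨hi', h⟩, rfl, rfl⟩
    · rintro ⟨i', ⟨hi', h⟩, rfl, rfl⟩
      exact ⟨⟨j, i', hi', rfl, rfl⟩, rfl, h⟩
  simpa only [e] using key

/-- Balls with the same bin and label share a lifetime, so in each bin the smaller collection is
contained in the larger. The difference counts surviving unmatched balls, each of which survives
with probability `exp (-s)`. -/
theorem lintegral_l1Dist_thin {s : ℝ} (hs : 0 ≤ s) (x y : Fin n → ℕ) :
    ∫⁻ ξ, (l1Dist (thin s ξ x) (thin s ξ y) : ℝ≥0∞) ∂lifeLaw (Fin n × ℕ) =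
      ENNReal.ofReal (Real.exp (-s)) * l1Dist x y := by
  have h1 : ∀ (ξ : Fin n × ℕ → ℝ) (j : Fin n) (a b : ℕ), a ≤ b →
      (((((Finset.range a).filter fun i => s < ξ (j, i)).card : ℤ) -
        ((Finset.range b).filter fun i => s < ξ (j, i)).card).natAbs : ℝ≥0∞) =
      ∑ i ∈ Finset.Ico a b, (Set.Ioi s).indicator 1 (ξ (j, i)) := by
    intro ξ j a b hab
    have : ((Finset.range a).filter fun i => s < ξ (j, i)).card +
        ((Finset.Ico a b).filter fun i => s < ξ (j, i)).card =
        ((Finset.range b).filter fun i => s < ξ (j, i)).card := by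
      simp only [Finset.card_filter]
      exact Finset.sum_range_add_sum_Ico _ hab
    rw [show ((((Finset.range a).filter fun i => s < ξ (j, i)).card : ℤ) -
      ((Finset.range b).filter fun i => s < ξ (j, i)).card).natAbs =
      ((Finset.Ico a b).filter fun i => s < ξ (j, i)).card by omega]
    simp [Set.indicator]
  have h2 : ∀ ξ : Fin n × ℕ → ℝ, (l1Dist (thin s ξ x) (thin s ξ y) : ℝ≥0∞) =
      ∑ j, ∑ i ∈ Finset.Ico (min (x j) (y j)) (max (x j) (y j)),
        (Set.Ioi s).indicator 1 (ξ (j, i)) := by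
    intro ξ
    simp only [l1Dist, thin, Nat.cast_sum]
    refine Finset.sum_congr rfl fun j _ => ?_
    rcases le_total (x j) (y j) with h | h
    · rw [min_eq_left h, max_eq_right h, h1 ξ j _ _ h]
    · rw [min_eq_right h, max_eq_left h, ← h1 ξ j _ _ h, ← Int.natAbs_neg, neg_sub]
  have h3 : ∀ p : Fin n × ℕ, ∫⁻ ξ, (Set.Ioi s).indicator 1 (ξ p) ∂lifeLaw (Fin n × ℕ) =
      ENNReal.ofReal (Real.exp (-s)) := by
    intro p
    rw [← (lintegral_map (f := (Set.Ioi s).indicator 1) (g := fun ξ : Fin n × ℕ → ℝ => ξ p)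
      (measurable_one.indicator measurableSet_Ioi) (by fun_prop)), Measure.infinitePi_map_eval,
      lintegral_indicator_one measurableSet_Ioi, expMeasure_Ioi one_pos hs, one_mul]
  have hm : ∀ p : Fin n × ℕ, Measurable fun ξ : Fin n × ℕ → ℝ =>
      (Set.Ioi s).indicator (1 : ℝ → ℝ≥0∞) (ξ p) := fun p =>
    (measurable_one.indicator measurableSet_Ioi).comp (measurable_pi_apply p)
  simp_rw [h2]
  rw [lintegral_finsetSum _ fun j _ => Finset.measurable_sum _ fun i _ => hm _]
  simp_rw [lintegral_finsetSum _ fun i _ => hm _, h3]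
  simp only [Finset.sum_const, Nat.card_Ico, nsmul_eq_mul, l1Dist, Nat.cast_sum]
  rw [← Finset.sum_mul, mul_comm]
  congr 1
  refine Finset.sum_congr rfl fun j _ => congrArg Nat.cast ?_
  omega

theorem thin_zero (s : ℝ) (ξ : Fin n × ℕ → ℝ) : thin s ξ 0 = 0 := by
  funext j; simp [thin]

theorem lintegral_total_thin {s : ℝ} (hs : 0 ≤ s) (x : Fin n → ℕ) :
    ∫⁻ ξ, (total (thin s ξ x) : ℝ≥0∞) ∂lifeLaw (Fin n × ℕ) =
      ENNReal.ofReal (Real.exp (-s)) * total x := by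
  simpa only [thin_zero, l1Dist_zero_right] using lintegral_l1Dist_thin hs x 0

end BallsBins

end

/-! ### Arrival counts, the model with fresh lifetimes and the comparison principle. -/

noncomputable section

namespace BallsBins

set_option linter.unusedSectionVars false

variable {d n : ℕ}

/-! ### Counting arrivals -/

/-- The time of arrival `k` when the waiting times are `g`. -/
def arrivalTime (g : ℕ → ℝ) (k : ℕ) : ℝ := ∑ i ∈ Finset.range (k + 1), g i

/-- The number of arrivals up to time `t` when the waiting times `g` are positive. -/
def arrivalCount (g : ℕ → ℝ) (t : ℝ) : ℕ := sInf {m | t < arrivalTime g m}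

theorem arrivalTime_zero (g : ℕ → ℝ) : arrivalTime g 0 = g 0 := by simp [arrivalTime]

theorem arrivalTime_succ (g : ℕ → ℝ) (k : ℕ) :
    arrivalTime g (k + 1) = arrivalTime g k + g (k + 1) := by
  simp [arrivalTime, Finset.sum_range_succ]

theorem arrivalTime_succ' (g : ℕ → ℝ) (k : ℕ) :
    arrivalTime g (k + 1) = g 0 + arrivalTime (fun i => g (i + 1)) k := by
  rw [arrivalTime, Finset.sum_range_succ', add_comm, arrivalTime]

theorem arrivalCount_eq_zero {g : ℕ → ℝ} {t : ℝ} (h : t < g 0) : arrivalCount g t = 0 :=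
  Nat.sInf_eq_zero.2 (.inl (by simpa [arrivalTime_zero] using h))

theorem arrivalCount_eq_succ {g : ℕ → ℝ} {t : ℝ} (h : g 0 ≤ t)
    (hg : ∃ m, t - g 0 < arrivalTime (fun i => g (i + 1)) m) :
    arrivalCount g t = arrivalCount (fun i => g (i + 1)) (t - g 0) + 1 := by
  have h1 : ∀ m, t < arrivalTime g (m + 1) ↔ t - g 0 < arrivalTime (fun i => g (i + 1)) m := by
    intro m
    rw [arrivalTime_succ', sub_lt_iff_lt_add']
  refine le_antisymm (Nat.sInf_le ((h1 _).2 (Nat.sInf_mem hg))) ?_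
  have h2 : arrivalCount g t ∈ {m | t < arrivalTime g m} :=
    Nat.sInf_mem (hg.imp' Nat.succ fun m hm => (h1 m).2 hm)
  rcases hm : arrivalCount g t with _ | m
  · rw [hm, Set.mem_ofPred_eq, arrivalTime_zero] at h2
    exact absurd h2 h.not_gt
  · rw [hm] at h2
    exact Nat.succ_le_succ (Nat.sInf_le ((h1 m).1 h2))

theorem measurable_arrivalTime (k : ℕ) : Measurable fun g : ℕ → ℝ => arrivalTime g k := by
  unfold arrivalTime; fun_prop

/-- The second alternative records the convention `sInf ∅ = 0` when no arrival time exceeds `t`. It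
is a null event, but measurability must account for it. -/
theorem arrivalCount_eq_iff {g : ℕ → ℝ} {t : ℝ} {m : ℕ} : arrivalCount g t = m ↔
    (t < arrivalTime g m ∧ ∀ k < m, arrivalTime g k ≤ t) ∨ (m = 0 ∧ ∀ k, arrivalTime g k ≤ t) := by
  constructor
  · rintro rfl
    rcases Set.eq_empty_or_nonempty {m | t < arrivalTime g m} with h | h
    · refine .inr ⟨by rw [arrivalCount, h, Nat.sInf_empty], fun k => not_lt.1 fun hk => ?_⟩
      exact (h ▸ hk : k ∈ (∅ : Set ℕ))
    · exact .inl ⟨Nat.sInf_mem h, fun k hk => not_lt.1 fun hk' => Nat.notMem_of_lt_sInf hk hk'⟩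
  · rintro (⟨h1, h2⟩ | ⟨rfl, h⟩)
    · refine le_antisymm (Nat.sInf_le h1) (le_csInf ⟨m, h1⟩ fun k hk => not_lt.1 fun hkm => ?_)
      exact (h2 k hkm).not_gt hk
    · refine Nat.sInf_eq_zero.2 (.inr (Set.eq_empty_iff_forall_notMem.2 fun k hk => (h k).not_gt hk))

theorem measurable_arrivalCount : Measurable fun p : ℝ × (ℕ → ℝ) => arrivalCount p.2 p.1 := by
  have h1 : ∀ k, MeasurableSet {p : ℝ × (ℕ → ℝ) | arrivalTime p.2 k ≤ p.1} := fun k =>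
    measurableSet_le ((measurable_arrivalTime k).comp measurable_snd) measurable_fst
  have h2 : ∀ k, MeasurableSet {p : ℝ × (ℕ → ℝ) | p.1 < arrivalTime p.2 k} := fun k =>
    measurableSet_lt measurable_fst ((measurable_arrivalTime k).comp measurable_snd)
  refine measurable_to_countable' fun m => ?_
  have : (fun p : ℝ × (ℕ → ℝ) => arrivalCount p.2 p.1) ⁻¹' {m} =
      ({p | p.1 < arrivalTime p.2 m} ∩ ⋂ k, ⋂ _ : k < m, {p | arrivalTime p.2 k ≤ p.1}) ∪
        ({p | m = 0} ∩ ⋂ k, {p | arrivalTime p.2 k ≤ p.1}) := by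
    ext p
    simp [arrivalCount_eq_iff]
  rw [this]
  exact ((h2 m).inter (.iInter fun k => .iInter fun _ => h1 k)).union
    ((MeasurableSet.const _).inter (.iInter fun k => h1 k))

section

variable {Λ : ℝ} [Fact (0 < Λ)]

instance isProbabilityMeasure_expMeasure_fact : IsProbabilityMeasure (expMeasure Λ) :=
  isProbabilityMeasure_expMeasure Fact.out

/-- If all arrivals occur by time `N`, so does the first one, and the sequence without its first
waiting time has the same property. By independence the probability `p` of this event satisfies `p ≤
q * p` with `q < 1`, so `p = 0`. -/
theorem ae_exists_lt_arrivalTime :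
    ∀ᵐ g ∂(Measure.infinitePi fun _ : ℕ => expMeasure Λ), ∀ t, ∃ m, t < arrivalTime g m := by
  have hΛ : 0 < Λ := Fact.out
  suffices h : ∀ N : ℕ, ∀ᵐ g ∂(Measure.infinitePi fun _ : ℕ => expMeasure Λ),
      ∃ m, (N : ℝ) < arrivalTime g m by
    filter_upwards [ae_all_iff.2 h] with g hg t
    obtain ⟨N, hN⟩ := exists_nat_gt t
    exact (hg N).imp fun m hm => hN.trans hm
  intro N
  set A : Set (ℕ → ℝ) := {g | ∀ m, arrivalTime g m ≤ N} with hA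
  have hAm : MeasurableSet A := by
    rw [hA, Set.ofPred_forall]
    exact .iInter fun m => measurableSet_le (measurable_arrivalTime m) measurable_const
  have key : (Measure.infinitePi fun _ : ℕ => expMeasure Λ) A ≤
      expMeasure Λ (Set.Iic (N : ℝ)) * (Measure.infinitePi fun _ : ℕ => expMeasure Λ) A := by
    conv_lhs => rw [← lintegral_indicator_one hAm,
      lintegral_infinitePi_succ _ (measurable_one.indicator hAm)]
    rw [← lintegral_indicator_one hAm, ← lintegral_indicator_one measurableSet_Iic,
      ← lintegral_mul_const _ (measurable_one.indicator measurableSet_Iic)]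
    refine lintegral_mono_ae ?_
    filter_upwards [expMeasure_ae_pos hΛ] with a ha
    rw [← lintegral_const_mul _ (measurable_one.indicator hAm)]
    refine lintegral_mono fun w => ?_
    by_cases h : seqCons a w ∈ A
    · have h0 : a ∈ Set.Iic (N : ℝ) := by simpa [arrivalTime_zero] using h 0
      have h1 : w ∈ A := fun m => by
        have := h (m + 1)
        rw [arrivalTime_succ'] at this
        simp only [seqCons_zero, seqCons_succ] at this
        linarith
      rw [Set.indicator_of_mem h, Set.indicator_of_mem h0, Set.indicator_of_mem h1]
      simp
    · rw [Set.indicator_of_notMem h]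
      exact zero_le
  have hq := expMeasure_Iic_lt_one hΛ (t := N) (by positivity)
  have h0 : (Measure.infinitePi fun _ : ℕ => expMeasure Λ) A = 0 := by
    by_contra hne
    refine (ENNReal.mul_lt_mul_left hne (measure_ne_top _ _) hq).not_ge ?_
    rwa [one_mul]
  filter_upwards [measure_eq_zero_iff_ae_notMem.1 h0] with g hg
  simpa [hA] using hg

end

/-! ### A load process with fresh lifetimes after each arrival -/

/-- The waiting time before an arrival, the choices of the arriving ball, and lifetimes that govern
the departures during the waiting time. -/
abbrev Step (d n : ℕ) : Type := (ℝ × (Fin d → Fin n)) × (Fin n × ℕ → ℝ)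

/-- The law of one step. -/
abbrev stepLaw (Λ : ℝ) (d n : ℕ) : Measure (Step d n) :=
  ((expMeasure Λ).prod (uniformOn Set.univ)).prod (lifeLaw (Fin n × ℕ))

/-- The law of a sequence of independent steps. -/
abbrev noiseLaw (Λ : ℝ) (d n : ℕ) : Measure (ℕ → Step d n) :=
  Measure.infinitePi fun _ => stepLaw Λ d n

/-- The load vector just after the first arrival. -/
def next [NeZero d] (s : Step d n) (x : Fin n → ℕ) : Fin n → ℕ :=
  place s.1.2 (thin s.1.1 s.2 x)

/-- The load vector at time `t`, after exactly `m` arrivals. -/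
def run [NeZero d] : ℕ → ℝ → (ℕ → Step d n) → (Fin n → ℕ) → Fin n → ℕ
  | 0, t, θ, x => thin t (θ 0).2 x
  | m + 1, t, θ, x => run m (t - (θ 0).1.1) (fun k => θ (k + 1)) (next (θ 0) x)

/-- The load vector at time `t`. -/
def loadAt [NeZero d] (t : ℝ) (θ : ℕ → Step d n) (x : Fin n → ℕ) : Fin n → ℕ :=
  run (arrivalCount (fun k => (θ k).1.1) t) t θ x

theorem measurable_next [NeZero d] :
    Measurable fun p : Step d n × (Fin n → ℕ) => next p.1 p.2 := by
  have h1 : Measurable fun q : (Fin d → Fin n) × (Fin n → ℕ) => place q.1 q.2 :=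
    Measurable.of_discrete
  exact h1.comp (f := fun p : Step d n × (Fin n → ℕ) => (p.1.1.2, thin p.1.1.1 p.1.2 p.2))
    ((by fun_prop : Measurable fun p : Step d n × (Fin n → ℕ) => p.1.1.2).prodMk
      (measurable_thin.comp
        (f := fun p : Step d n × (Fin n → ℕ) => (p.1.1.1, p.1.2, p.2)) (by fun_prop)))

theorem measurable_run [NeZero d] (m : ℕ) :
    Measurable fun p : ℝ × (ℕ → Step d n) × (Fin n → ℕ) => run m p.1 p.2.1 p.2.2 := by
  induction m with
  | zero =>
    exact measurable_thin.comp
      (f := fun p : ℝ × (ℕ → Step d n) × (Fin n → ℕ) => (p.1, (p.2.1 0).2, p.2.2)) (by fun_prop)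
  | succ m ih =>
    have h : Measurable fun p : ℝ × (ℕ → Step d n) × (Fin n → ℕ) => next (p.2.1 0) p.2.2 :=
      measurable_next.comp
        (f := fun p : ℝ × (ℕ → Step d n) × (Fin n → ℕ) => (p.2.1 0, p.2.2)) (by fun_prop)
    exact ih.comp (f := fun p : ℝ × (ℕ → Step d n) × (Fin n → ℕ) =>
      (p.1 - (p.2.1 0).1.1, (fun k => p.2.1 (k + 1)), next (p.2.1 0) p.2.2)) (by fun_prop)

theorem measurable_loadAt [NeZero d] :
    Measurable fun p : ℝ × (ℕ → Step d n) × (Fin n → ℕ) => loadAt p.1 p.2.1 p.2.2 := by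
  have h1 : Measurable fun q : ℕ × (ℝ × (ℕ → Step d n) × (Fin n → ℕ)) =>
      run q.1 q.2.1 q.2.2.1 q.2.2.2 :=
    measurable_from_prod_countable_right fun m => measurable_run m
  have h2 : Measurable fun p : ℝ × (ℕ → Step d n) × (Fin n → ℕ) =>
      arrivalCount (fun k => (p.2.1 k).1.1) p.1 :=
    measurable_arrivalCount.comp (f := fun p : ℝ × (ℕ → Step d n) × (Fin n → ℕ) =>
      (p.1, fun k => (p.2.1 k).1.1)) (by fun_prop)
  exact h1.comp (h2.prodMk measurable_id)

theorem measurable_loadAt_noise [NeZero d] (t : ℝ) (x : Fin n → ℕ) :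
    Measurable fun θ : ℕ → Step d n => loadAt t θ x :=
  measurable_loadAt.comp (f := fun θ => (t, θ, x)) (by fun_prop)

theorem loadAt_of_lt [NeZero d] {t : ℝ} {θ : ℕ → Step d n} (h : t < (θ 0).1.1)
    (x : Fin n → ℕ) : loadAt t θ x = thin t (θ 0).2 x := by
  rw [loadAt, arrivalCount_eq_zero h, run]

theorem loadAt_of_le [NeZero d] {t : ℝ} {θ : ℕ → Step d n} (h : (θ 0).1.1 ≤ t)
    (hθ : ∀ t, ∃ m, t < arrivalTime (fun k => (θ (k + 1)).1.1) m) (x : Fin n → ℕ) :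
    loadAt t θ x = loadAt (t - (θ 0).1.1) (fun k => θ (k + 1)) (next (θ 0) x) := by
  rw [loadAt, arrivalCount_eq_succ h (hθ _), run, loadAt]

variable [NeZero d] [NeZero n] {Λ : ℝ} [Fact (0 < Λ)]

instance isProbabilityMeasure_uniformOn_choices :
    IsProbabilityMeasure (uniformOn (Set.univ : Set (Fin d → Fin n))) :=
  isProbabilityMeasure_uniformOn Set.finite_univ Set.univ_nonempty

variable (d n Λ) in
theorem noiseLaw_map_gap : (noiseLaw Λ d n).map (fun θ k => (θ k).1.1) =
    Measure.infinitePi fun _ : ℕ => expMeasure Λ := by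
  rw [Measure.infinitePi_map_pi _ (f := fun _ (s : Step d n) => s.1.1) (by fun_prop)]
  congr 1
  funext _
  change (stepLaw Λ d n).map (Prod.fst ∘ Prod.fst) = _
  rw [← Measure.map_map (by fun_prop) (by fun_prop)]
  simp

theorem ae_noise_exists_lt_arrivalTime : ∀ᵐ θ ∂(noiseLaw Λ d n),
    ∀ t, ∃ m, t < arrivalTime (fun k => (θ k).1.1) m := by
  have h := ae_exists_lt_arrivalTime (Λ := Λ)
  rw [← noiseLaw_map_gap d n Λ] at h
  exact ae_of_ae_map (f := fun (θ : ℕ → Step d n) k => (θ k).1.1)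
    (Measurable.aemeasurable (by fun_prop)) h

/-- The first-step equation for two load vectors with the same noise. -/
theorem lintegral_loadAt_pair {H : (Fin n → ℕ) → (Fin n → ℕ) → ℝ≥0∞} (t : ℝ)
    (x y : Fin n → ℕ) :
    ∫⁻ θ, H (loadAt t θ x) (loadAt t θ y) ∂(noiseLaw Λ d n) =
      ∫⁻ s, (if t < s.1.1 then H (thin t s.2 x) (thin t s.2 y) else
        ∫⁻ θ, H (loadAt (t - s.1.1) θ (next s x)) (loadAt (t - s.1.1) θ (next s y))
          ∂(noiseLaw Λ d n)) ∂(stepLaw Λ d n) := by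
  have hH : Measurable fun q : (Fin n → ℕ) × (Fin n → ℕ) => H q.1 q.2 := Measurable.of_discrete
  refine (lintegral_infinitePi_succ _ (hH.comp
    ((measurable_loadAt_noise t x).prodMk (measurable_loadAt_noise t y)))).trans ?_
  refine lintegral_congr fun s => ?_
  split_ifs with h
  · simp [loadAt_of_lt (θ := seqCons s _) (t := t) (by simpa using h)]
  · refine lintegral_congr_ae ?_
    filter_upwards [ae_noise_exists_lt_arrivalTime (d := d) (n := n) (Λ := Λ)] with θ hθ
    simp only [Function.comp_apply]
    rw [loadAt_of_le (θ := seqCons s θ) (by simpa using h) (by simpa using hθ),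
      loadAt_of_le (θ := seqCons s θ) (by simpa using h) (by simpa using hθ)]
    simp

theorem stepLaw_gap_le (T : ℝ) :
    stepLaw Λ d n {s | s.1.1 ≤ T} = expMeasure Λ (Set.Iic T) := by
  have : {s : Step d n | s.1.1 ≤ T} = (Set.Iic T ×ˢ Set.univ) ×ˢ Set.univ := by
    ext s; simp
  rw [this, Measure.prod_prod, Measure.prod_prod]
  simp

theorem stepLaw_ae_pos : ∀ᵐ s ∂(stepLaw Λ d n), 0 < s.1.1 :=
  Measure.quasiMeasurePreserving_fst.ae
    (Measure.quasiMeasurePreserving_fst.ae (expMeasure_ae_pos Fact.out))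

/-- A bounded subsolution of the first-step equation is at most any supersolution. -/
theorem le_of_first_step {S : Type*} {F G : ℝ → S → ℝ≥0∞} {a : ℝ → Step d n → S → ℝ≥0∞}
    {φ : Step d n → S → S} {B : ℝ≥0∞} (hB : B ≠ ⊤) (hFB : ∀ t x, F t x ≤ B)
    (hF : ∀ t, 0 ≤ t → ∀ x, F t x ≤
      ∫⁻ s, (if t < s.1.1 then a t s x else F (t - s.1.1) (φ s x)) ∂(stepLaw Λ d n))
    (hG : ∀ t, 0 ≤ t → ∀ x,
      ∫⁻ s, (if t < s.1.1 then a t s x else G (t - s.1.1) (φ s x)) ∂(stepLaw Λ d n) ≤ G t x)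
    {t : ℝ} (ht : 0 ≤ t) (x : S) : F t x ≤ G t x := by
  set q := expMeasure Λ (Set.Iic t) with hq
  have hq1 : q < 1 := expMeasure_Iic_lt_one Fact.out ht
  -- The error is carried only past a first arrival within the remaining time, an event of
  -- probability at most `q`. Each iteration thus gains a factor `q < 1`.
  have key : ∀ k : ℕ, ∀ r, 0 ≤ r → r ≤ t → ∀ x, F r x ≤ G r x + q ^ k * B := by
    intro k
    induction k with
    | zero => intro r _ _ x; simpa using (hFB r x).trans le_add_self
    | succ k ih =>
      intro r hr hrt x
      have hm : MeasurableSet {s : Step d n | s.1.1 ≤ r} :=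
        measurableSet_le (by fun_prop) measurable_const
      calc F r x ≤ _ := hF r hr x
        _ ≤ ∫⁻ s, ((if r < s.1.1 then a r s x else G (r - s.1.1) (φ s x)) +
            {s : Step d n | s.1.1 ≤ r}.indicator (fun _ => q ^ k * B) s) ∂(stepLaw Λ d n) := by
          refine lintegral_mono_ae ?_
          filter_upwards [stepLaw_ae_pos (Λ := Λ) (d := d) (n := n)] with s hs
          split_ifs with h
          · exact le_self_add
          · rw [Set.indicator_of_mem (show s ∈ {s : Step d n | s.1.1 ≤ r} from not_lt.1 h)]
            exact ih _ (sub_nonneg.2 (not_lt.1 h)) (by linarith) _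
        _ ≤ G r x + q ^ (k + 1) * B := by
          rw [lintegral_add_right _ (measurable_const.indicator hm), lintegral_indicator_const hm,
            stepLaw_gap_le, pow_succ, mul_right_comm]
          refine add_le_add (hG r hr x) ?_
          gcongr
          exact measure_mono (Set.Iic_subset_Iic.2 hrt)
  have hlim : Filter.Tendsto (fun k : ℕ => G t x + q ^ k * B) Filter.atTop
      (nhds (G t x + 0 * B)) :=
    (ENNReal.Tendsto.mul_const (ENNReal.tendsto_pow_atTop_nhds_zero_of_lt_one hq1)
      (.inr hB)).const_add _
  rw [zero_mul, add_zero] at hlim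
  exact ge_of_tendsto' hlim fun k => key k t ht le_rfl x

end BallsBins

end

/-! ### Semigroup property, contraction and mean number of balls. -/

noncomputable section

namespace BallsBins

set_option linter.unusedSectionVars false

variable {d n : ℕ} [NeZero d] [NeZero n] {Λ : ℝ} [Fact (0 < Λ)]

theorem lintegral_stepLaw {F : Step d n → ℝ≥0∞} (hF : Measurable F) :
    ∫⁻ s, F s ∂(stepLaw Λ d n) =
      ∫⁻ g, ∫⁻ c, ∫⁻ ξ, F ((g, c), ξ) ∂lifeLaw (Fin n × ℕ) ∂uniformOn Set.univ
        ∂(expMeasure Λ) := by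
  rw [lintegral_prod _ hF.aemeasurable, lintegral_prod]
  exact (Measurable.lintegral_prod_right' hF).aemeasurable

/-- The expectation of `f` at time `t`, started from `x`. -/
def evol (Λ : ℝ) (d : ℕ) [NeZero d] (t : ℝ) (f : (Fin n → ℕ) → ℝ≥0∞) (x : Fin n → ℕ) : ℝ≥0∞ :=
  ∫⁻ θ, f (loadAt t θ x) ∂(noiseLaw Λ d n)

theorem measurable_evol (f : (Fin n → ℕ) → ℝ≥0∞) :
    Measurable fun p : ℝ × (Fin n → ℕ) => evol Λ d p.1 f p.2 := by
  refine Measurable.lintegral_prod_right' (f := fun q : (ℝ × (Fin n → ℕ)) × (ℕ → Step d n) =>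
    f (loadAt q.1.1 q.2 q.1.2)) ?_
  exact (Measurable.of_discrete (f := f)).comp (measurable_loadAt.comp
    (f := fun q : (ℝ × (Fin n → ℕ)) × (ℕ → Step d n) => (q.1.1, q.2, q.1.2)) (by fun_prop))

theorem evol_first_step (t : ℝ) (f : (Fin n → ℕ) → ℝ≥0∞) (x : Fin n → ℕ) :
    evol Λ d t f x = ∫⁻ s, (if t < s.1.1 then f (thin t s.2 x) else
      evol Λ d (t - s.1.1) f (next s x)) ∂(stepLaw Λ d n) :=
  lintegral_loadAt_pair (H := fun x _ => f x) t x x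

theorem measurable_first_step {a : (Fin n → ℕ) → ℝ≥0∞} {F : ℝ → (Fin n → ℕ) → ℝ≥0∞}
    (hF : Measurable fun p : ℝ × (Fin n → ℕ) => F p.1 p.2) :
    Measurable fun p : ℝ × Step d n × (Fin n → ℕ) =>
      if p.1 < p.2.1.1.1 then a (thin p.1 p.2.1.2 p.2.2) else
        F (p.1 - p.2.1.1.1) (next p.2.1 p.2.2) := by
  have hn : Measurable fun p : ℝ × Step d n × (Fin n → ℕ) => next p.2.1 p.2.2 :=
    measurable_next.comp (f := fun p : ℝ × Step d n × (Fin n → ℕ) => p.2) (by fun_prop)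
  refine Measurable.ite (measurableSet_lt (by fun_prop) (by fun_prop)) ?_ ?_
  · exact (Measurable.of_discrete (f := a)).comp (measurable_thin.comp
      (f := fun p : ℝ × Step d n × (Fin n → ℕ) => (p.1, p.2.1.2, p.2.2)) (by fun_prop))
  · exact hF.comp (f := fun p : ℝ × Step d n × (Fin n → ℕ) =>
      (p.1 - p.2.1.1.1, next p.2.1 p.2.2)) (by fun_prop)

/-- Departures before time `t` and the dynamics after time `t` may be separated. -/
theorem evol_add_first_step {s t : ℝ} (hs : 0 ≤ s) (ht : 0 ≤ t) (f : (Fin n → ℕ) → ℝ≥0∞)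
    (x : Fin n → ℕ) :
    evol Λ d (t + s) f x = ∫⁻ z, (if t < z.1.1 then evol Λ d s f (thin t z.2 x) else
      evol Λ d (t - z.1.1 + s) f (next z x)) ∂(stepLaw Λ d n) := by
  have hE := measurable_evol (Λ := Λ) (d := d) f
  have m0 := measurable_first_step (d := d) (a := f) (F := fun t => evol Λ d t f) hE
  have mshift : Measurable fun p : ℝ × (Fin n → ℕ) => evol Λ d (p.1 + s) f p.2 :=
    hE.comp (f := fun p : ℝ × (Fin n → ℕ) => (p.1 + s, p.2)) (by fun_prop)
  have m2 := measurable_first_step (d := d) (a := evol Λ d s f)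
    (F := fun t => evol Λ d (t + s) f) mshift
  have hthin : ∀ y, evol Λ d s f y = ∫⁻ g, ∫⁻ c, ∫⁻ ξ,
      (if s < g then f (thin s ξ y) else evol Λ d (s - g) f (next ((g, c), ξ) y))
        ∂lifeLaw (Fin n × ℕ) ∂uniformOn (Set.univ : Set (Fin d → Fin n)) ∂(expMeasure Λ) := by
    intro y
    rw [evol_first_step, lintegral_stepLaw]
    exact m0.comp (f := fun z : Step d n => (s, z, y)) (by fun_prop)
  have mH : ∀ F : Step d n → ℝ≥0∞, Measurable F → Measurable fun g : ℝ =>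
      ∫⁻ c, ∫⁻ ξ, F ((g, c), ξ) ∂lifeLaw (Fin n × ℕ)
        ∂uniformOn (Set.univ : Set (Fin d → Fin n)) := fun F hF =>
    Measurable.lintegral_prod_right' (f := fun q : ℝ × (Fin d → Fin n) =>
      ∫⁻ ξ, F (q, ξ) ∂lifeLaw (Fin n × ℕ)) (Measurable.lintegral_prod_right' hF)
  have m1 : Measurable fun z : Step d n => (if t + s < z.1.1 then f (thin (t + s) z.2 x) else
      evol Λ d (t + s - z.1.1) f (next z x)) :=
    m0.comp (f := fun z : Step d n => (t + s, z, x)) (by fun_prop)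
  have m2 : Measurable fun z : Step d n => (if t < z.1.1 then
      evol Λ d s f (thin t z.2 x) else evol Λ d (t - z.1.1 + s) f (next z x)) :=
    m2.comp (f := fun z : Step d n => (t, z, x)) (by fun_prop)
  rw [evol_first_step, lintegral_stepLaw m1, lintegral_stepLaw m2,
    ← lintegral_add_compl _ (measurableSet_Ioi (a := t))]
  conv_rhs => rw [← lintegral_add_compl _ (measurableSet_Ioi (a := t))]
  congr 1
  · rw [setLIntegral_expMeasure_Ioi _ ht (mH _ m1), setLIntegral_expMeasure_Ioi _ ht (mH _ m2)]
    congr 1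
    have hswap : ∀ g : ℝ, AEMeasurable (Function.uncurry fun (ξ' : Fin n × ℕ → ℝ)
        (c : Fin d → Fin n) => ∫⁻ ξ, evol Λ d (s - g) f (place c (thin g ξ (thin t ξ' x)))
          ∂lifeLaw (Fin n × ℕ)) ((lifeLaw (Fin n × ℕ)).prod (uniformOn Set.univ)) := by
      intro g
      refine Measurable.aemeasurable (Measurable.lintegral_prod_right' (f := fun q :
        ((Fin n × ℕ → ℝ) × (Fin d → Fin n)) × (Fin n × ℕ → ℝ) =>
        evol Λ d (s - g) f (next ((g, q.1.2), q.2) (thin t q.1.1 x))) ?_)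
      refine (Measurable.of_discrete (f := evol Λ d (s - g) f)).comp
        (measurable_next.comp (f := fun q : ((Fin n × ℕ → ℝ) × (Fin d → Fin n)) ×
          (Fin n × ℕ → ℝ) => (((g, q.1.2), q.2), thin t q.1.1 x)) ?_)
      exact Measurable.prodMk (by fun_prop) ((measurable_thin_right t x).comp (by fun_prop))
    have h1 : ∀ᵐ g ∂(expMeasure Λ), (∫⁻ c, ∫⁻ ξ, (if t + s < t + g then f (thin (t + s) ξ x) else
        evol Λ d (t + s - (t + g)) f (next ((t + g, c), ξ) x)) ∂lifeLaw (Fin n × ℕ)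
          ∂uniformOn (Set.univ : Set (Fin d → Fin n))) =
        ∫⁻ ξ', ∫⁻ c, ∫⁻ ξ, (if s < g then f (thin s ξ (thin t ξ' x)) else
          evol Λ d (s - g) f (next ((g, c), ξ) (thin t ξ' x))) ∂lifeLaw (Fin n × ℕ)
            ∂uniformOn (Set.univ : Set (Fin d → Fin n)) ∂lifeLaw (Fin n × ℕ) := by
      filter_upwards [expMeasure_ae_pos (r := Λ) Fact.out] with g hg
      by_cases h : s < g
      · simp only [add_lt_add_iff_left, if_pos h, lintegral_const, measure_univ, mul_one]
        exact lintegral_thin_add ht hs x f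
      · simp only [add_lt_add_iff_left, if_neg h, add_sub_add_left_eq_sub, next]
        conv_rhs => rw [lintegral_lintegral_swap (f := fun (ξ' : Fin n × ℕ → ℝ)
          (c : Fin d → Fin n) => ∫⁻ ξ, evol Λ d (s - g) f (place c (thin g ξ (thin t ξ' x)))
            ∂lifeLaw (Fin n × ℕ)) (hswap g)]
        refine lintegral_congr fun c => ?_
        exact lintegral_thin_add ht hg.le x fun y => evol Λ d (s - g) f (place c y)
    rw [lintegral_congr_ae h1]
    have h2 : ∀ᵐ g ∂(expMeasure Λ), (∫⁻ c, ∫⁻ ξ, (if t < t + g then evol Λ d s f (thin t ξ x) else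
        evol Λ d (t - (t + g) + s) f (next ((t + g, c), ξ) x)) ∂lifeLaw (Fin n × ℕ)
          ∂uniformOn (Set.univ : Set (Fin d → Fin n))) =
        ∫⁻ ξ, evol Λ d s f (thin t ξ x) ∂lifeLaw (Fin n × ℕ) := by
      filter_upwards [expMeasure_ae_pos (r := Λ) Fact.out] with g hg
      simp [hg]
    rw [lintegral_congr_ae h2, lintegral_lintegral_swap]
    · simp only [lintegral_const, measure_univ, mul_one]
      exact lintegral_congr fun ξ' => (hthin _).symm
    · refine Measurable.aemeasurable ?_
      refine Measurable.lintegral_prod_right' (f := fun q : (ℝ × (Fin n × ℕ → ℝ)) ×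
        (Fin d → Fin n) => ∫⁻ ξ, (if s < q.1.1 then f (thin s ξ (thin t q.1.2 x)) else
          evol Λ d (s - q.1.1) f (next ((q.1.1, q.2), ξ) (thin t q.1.2 x)))
            ∂lifeLaw (Fin n × ℕ)) ?_
      refine Measurable.lintegral_prod_right' (f := fun q : ((ℝ × (Fin n × ℕ → ℝ)) ×
        (Fin d → Fin n)) × (Fin n × ℕ → ℝ) =>
          if s < q.1.1.1 then f (thin s q.2 (thin t q.1.1.2 x)) else
          evol Λ d (s - q.1.1.1) f (next ((q.1.1.1, q.1.2), q.2) (thin t q.1.1.2 x))) ?_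
      have hq := (measurable_thin_right t x).comp (f := fun q : ((ℝ × (Fin n × ℕ → ℝ)) ×
        (Fin d → Fin n)) × (Fin n × ℕ → ℝ) => q.1.1.2) (by fun_prop)
      exact m0.comp (f := fun q : ((ℝ × (Fin n × ℕ → ℝ)) × (Fin d → Fin n)) ×
        (Fin n × ℕ → ℝ) => (s, ((q.1.1.1, q.1.2), q.2), thin t q.1.1.2 x))
        (Measurable.prodMk (by fun_prop) (Measurable.prodMk (by fun_prop) hq))
  -- If the first arrival is at `g ≤ t`, the two integrands agree.
  · refine setLIntegral_congr_fun measurableSet_Ioi.compl fun g hg => ?_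
    have hg' : g ≤ t := not_lt.1 hg
    simp only [if_neg hg'.not_gt, if_neg (show ¬ t + s < g by linarith), add_sub_right_comm]

/-- The Chapman–Kolmogorov equation. -/
theorem evol_add {s t : ℝ} (hs : 0 ≤ s) (ht : 0 ≤ t) {f : (Fin n → ℕ) → ℝ≥0∞}
    (hf : ∀ x, f x ≤ 1) (x : Fin n → ℕ) :
    evol Λ d (t + s) f x = evol Λ d t (evol Λ d s f) x := by
  have hb : ∀ (f : (Fin n → ℕ) → ℝ≥0∞), (∀ x, f x ≤ 1) → ∀ t x, evol Λ d t f x ≤ 1 := by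
    intro f hf t x
    refine (lintegral_mono fun θ => hf _).trans ?_
    simp
  -- As functions of `t`, both sides are bounded solutions of the same first-step equation, so the
  -- comparison principle applies in both directions.
  refine le_antisymm ?_ ?_
  · exact le_of_first_step (Λ := Λ) (d := d) (n := n) (F := fun t x => evol Λ d (t + s) f x)
      (G := fun t x => evol Λ d t (evol Λ d s f) x)
      (a := fun t z x => evol Λ d s f (thin t z.2 x)) ENNReal.one_ne_top (fun t x => hb f hf _ x)
      (fun t ht x => (evol_add_first_step hs ht f x).le)
      (fun t _ x => (evol_first_step t _ x).ge) ht x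
  · exact le_of_first_step (Λ := Λ) (d := d) (n := n) (G := fun t x => evol Λ d (t + s) f x)
      (F := fun t x => evol Λ d t (evol Λ d s f) x)
      (a := fun t z x => evol Λ d s f (thin t z.2 x)) ENNReal.one_ne_top
      (fun t x => hb _ (hb f hf s) _ x) (fun t _ x => (evol_first_step t _ x).le)
      (fun t ht x => (evol_add_first_step hs ht f x).ge) ht x

/-- Monotone convergence. It lets `le_of_first_step`, which needs a bounded subsolution, be applied
to the truncations of an unbounded quantity. -/
theorem lintegral_le_of_forall_min {α : Type*} [MeasurableSpace α] {μ : Measure α} {h : α → ℕ}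
    (hm : Measurable h) {C : ℝ≥0∞} (hC : ∀ B : ℕ, ∫⁻ x, (min (h x) B : ℕ) ∂μ ≤ C) :
    ∫⁻ x, h x ∂μ ≤ C := by
  have : ∀ x, (h x : ℝ≥0∞) = ⨆ B : ℕ, ((min (h x) B : ℕ) : ℝ≥0∞) := by
    intro x
    refine le_antisymm ?_ (iSup_le fun B => by exact_mod_cast min_le_left _ _)
    exact le_iSup_of_le (h x) (by simp)
  simp_rw [this]
  rw [lintegral_iSup]
  · exact iSup_le hC
  · intro B
    exact (Measurable.of_discrete (f := fun k : ℕ => ((min k B : ℕ) : ℝ≥0∞))).comp hm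
  · intro B B' hB x
    exact Nat.cast_le.2 (min_le_min_left _ hB)

theorem measurable_l1Dist {α : Type*} [MeasurableSpace α] {f g : α → Fin n → ℕ}
    (hf : Measurable f) (hg : Measurable g) : Measurable fun a => l1Dist (f a) (g a) :=
  (Measurable.of_discrete (f := fun q : (Fin n → ℕ) × (Fin n → ℕ) => l1Dist q.1 q.2)).comp
    (hf.prodMk hg)

theorem measurable_l1Dist_cast {α : Type*} [MeasurableSpace α] {f g : α → Fin n → ℕ}
    (hf : Measurable f) (hg : Measurable g) :
    Measurable fun a => (l1Dist (f a) (g a) : ℝ≥0∞) :=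
  (Measurable.of_discrete (f := fun k : ℕ => (k : ℝ≥0∞))).comp (measurable_l1Dist hf hg)

/-- Two systems with the same noise approach each other exponentially fast. -/
theorem lintegral_l1Dist_loadAt_le {t : ℝ} (ht : 0 ≤ t) (x y : Fin n → ℕ) :
    ∫⁻ θ, (l1Dist (loadAt t θ x) (loadAt t θ y) : ℝ≥0∞) ∂(noiseLaw Λ d n) ≤
      ENNReal.ofReal (Real.exp (-t)) * l1Dist x y := by
  refine lintegral_le_of_forall_min ?_ fun B => ?_
  · exact measurable_l1Dist (measurable_loadAt_noise t x) (measurable_loadAt_noise t y)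
  refine le_of_first_step (Λ := Λ) (d := d) (n := n) (S := (Fin n → ℕ) × (Fin n → ℕ))
    (F := fun t p => ∫⁻ θ, (min (l1Dist (loadAt t θ p.1) (loadAt t θ p.2)) B : ℕ)
      ∂(noiseLaw Λ d n))
    (G := fun t p => ENNReal.ofReal (Real.exp (-t)) * l1Dist p.1 p.2)
    (a := fun t s p => (min (l1Dist (thin t s.2 p.1) (thin t s.2 p.2)) B : ℕ))
    (φ := fun s p => (next s p.1, next s p.2)) (ENNReal.natCast_ne_top B) (fun t p => ?_)
    (fun t _ p => (lintegral_loadAt_pair (H := fun x y => ((min (l1Dist x y) B : ℕ) : ℝ≥0∞))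
      t p.1 p.2).le) (fun t ht p => ?_) ht (x, y)
  · refine (lintegral_mono (g := fun _ => (B : ℝ≥0∞)) fun θ => ?_).trans ?_
    · exact Nat.cast_le.2 (min_le_right _ _)
    · simp
  · have hth : ∀ x : Fin n → ℕ, Measurable fun q : Step d n => thin (min t q.1.1) q.2 x :=
      fun x => measurable_thin_comp (by fun_prop) (by fun_prop) (by fun_prop)
    have hmt : Measurable fun q : Step d n =>
        (l1Dist (thin (min t q.1.1) q.2 p.1) (thin (min t q.1.1) q.2 p.2) : ℝ≥0∞) :=
      measurable_l1Dist_cast (hth p.1) (hth p.2)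
    -- The decay still to come after a first arrival at `g`. Multiplied by the decay `exp (-(min t
    -- g))` before it, this is `exp (-t)` in either case.
    set e : ℝ → ℝ≥0∞ := fun g => if t < g then 1 else ENNReal.ofReal (Real.exp (-(t - g))) with he
    have hem : Measurable e := Measurable.ite (measurableSet_lt (by fun_prop) (by fun_prop))
      (by fun_prop) (by fun_prop)
    have hle : ∀ s : Step d n, (if t < s.1.1 then
          ((min (l1Dist (thin t s.2 p.1) (thin t s.2 p.2)) B : ℕ) : ℝ≥0∞) else
          ENNReal.ofReal (Real.exp (-(t - s.1.1))) * l1Dist (next s p.1) (next s p.2)) ≤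
        e s.1.1 * l1Dist (thin (min t s.1.1) s.2 p.1) (thin (min t s.1.1) s.2 p.2) := by
      intro s
      simp only [he]
      split_ifs with h
      · rw [min_eq_left h.le, one_mul]
        exact Nat.cast_le.2 (min_le_left _ _)
      · rw [min_eq_right (not_lt.1 h)]
        gcongr
        exact l1Dist_place_le _ _ _
    have hm1 : Measurable fun s : Step d n => e s.1.1 *
        l1Dist (thin (min t s.1.1) s.2 p.1) (thin (min t s.1.1) s.2 p.2) :=
      Measurable.mul (hem.comp (by fun_prop)) hmt
    refine (lintegral_mono hle).trans ?_
    rw [lintegral_prod _ hm1.aemeasurable]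
    have hpos : ∀ᵐ m ∂((expMeasure Λ).prod (uniformOn (Set.univ : Set (Fin d → Fin n)))),
        0 < m.1 := Measure.quasiMeasurePreserving_fst.ae (expMeasure_ae_pos Fact.out)
    refine (lintegral_mono_ae (g := fun _ => ENNReal.ofReal (Real.exp (-t)) * l1Dist p.1 p.2)
      ?_).trans (by simp)
    filter_upwards [hpos] with m hm
    have hm' : Measurable fun ξ : Fin n × ℕ → ℝ =>
        (l1Dist (thin (min t m.1) ξ p.1) (thin (min t m.1) ξ p.2) : ℝ≥0∞) :=
      measurable_l1Dist_cast (measurable_thin_right _ _) (measurable_thin_right _ _)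
    refine (lintegral_const_mul _ hm').trans_le ?_
    rw [lintegral_l1Dist_thin (le_min ht hm.le), ← mul_assoc]
    gcongr
    simp only [he]
    split_ifs with h
    · rw [min_eq_left h.le, one_mul]
    · rw [min_eq_right (not_lt.1 h), ← ENNReal.ofReal_mul (by positivity), ← Real.exp_add]
      ring_nf
      exact le_rfl

/-- The first-step equation for `Λ * (1 - exp (-t))`, the mean number of surviving arrivals. A first
ball arriving at `g` survives with probability `exp (-(t - g))`, and later balls contribute the same
expression with time `t - g`. -/
theorem setLIntegral_expMeasure_mean {t : ℝ} (ht : 0 ≤ t) :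
    ∫⁻ g in Set.Iic t, (ENNReal.ofReal (Real.exp (-(t - g))) +
      ENNReal.ofReal (Λ * (1 - Real.exp (-(t - g))))) ∂(expMeasure Λ) =
      ENNReal.ofReal (Λ * (1 - Real.exp (-t))) := by
  have hΛ : 0 < Λ := Fact.out
  set k : ℝ → ℝ := fun g => Λ * Real.exp (-(Λ * g)) *
    (Real.exp (-(t - g)) + Λ * (1 - Real.exp (-(t - g)))) with hk
  -- This antiderivative of `k` vanishes at `t` and equals `-Λ * (1 - exp (-t))` at `0`.
  have hd : ∀ g ∈ Set.uIcc 0 t, HasDerivAt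
      (fun g => Λ * Real.exp (-(Λ * g)) * (Real.exp (-(t - g)) - 1)) (k g) g := by
    intro g _
    have h1 : HasDerivAt (fun g : ℝ => Real.exp (-(Λ * g))) (Real.exp (-(Λ * g)) * -(Λ * 1)) g :=
      ((hasDerivAt_id g).const_mul Λ).neg.exp
    have h2 : HasDerivAt (fun g : ℝ => Real.exp (-(t - g))) (Real.exp (-(t - g)) * -(-1)) g :=
      (((hasDerivAt_id g).const_sub t).neg).exp
    refine ((h1.const_mul Λ).mul (h2.sub_const 1)).congr_deriv ?_
    simp only [hk]
    ring
  have hc : Continuous k := by fun_prop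
  have hint : ∫ g in (0 : ℝ)..t, k g = Λ * (1 - Real.exp (-t)) := by
    rw [intervalIntegral.integral_eq_sub_of_hasDerivAt hd (hc.intervalIntegrable _ _)]
    simp
    ring
  have hk0 : ∀ g ∈ Set.Ioc 0 t, 0 ≤ k g := by
    intro g hg
    have : Real.exp (-(t - g)) ≤ 1 := Real.exp_le_one_iff.2 (by linarith [hg.2])
    have : 0 ≤ 1 - Real.exp (-(t - g)) := by linarith
    simp only [hk]
    positivity
  have hm : Measurable fun g : ℝ => ENNReal.ofReal (Real.exp (-(t - g))) +
      ENNReal.ofReal (Λ * (1 - Real.exp (-(t - g)))) := by fun_prop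
  rw [expMeasure_eq, restrict_withDensity measurableSet_Iic,
    lintegral_withDensity_eq_lintegral_mul _ (measurable_exponentialPDF Λ) hm, ← hint,
    intervalIntegral.integral_of_le ht,
    ofReal_integral_eq_lintegral_ofReal (hc.integrableOn_Ioc)
      ((ae_restrict_iff' measurableSet_Ioc).2 (.of_forall hk0)),
    ← lintegral_indicator measurableSet_Iic, ← lintegral_indicator measurableSet_Ioc]
  refine lintegral_congr_ae ?_
  filter_upwards [(Set.finite_singleton (0 : ℝ)).countable.ae_notMem volume] with g hg
  rcases lt_or_gt_of_ne (show g ≠ 0 by simpa using hg) with h0 | h0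
  · rw [Set.indicator_of_notMem (s := Set.Ioc 0 t) fun h => h0.not_gt h.1]
    simp [Set.indicator, exponentialPDF_of_neg h0]
  · by_cases hgt : g ≤ t
    · rw [Set.indicator_of_mem (show g ∈ Set.Iic t from hgt),
        Set.indicator_of_mem (show g ∈ Set.Ioc 0 t from ⟨h0, hgt⟩), Pi.mul_apply,
        exponentialPDF_of_nonneg h0.le]
      have : Real.exp (-(t - g)) ≤ 1 := Real.exp_le_one_iff.2 (by linarith)
      rw [← ENNReal.ofReal_add (by positivity) (mul_nonneg hΛ.le (by linarith)),
        ← ENNReal.ofReal_mul (by positivity)]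
    · rw [Set.indicator_of_notMem (show g ∉ Set.Iic t from hgt),
        Set.indicator_of_notMem (show g ∉ Set.Ioc 0 t from fun h => hgt h.2)]

/-- The expected number of balls. -/
theorem evol_total_le {t : ℝ} (ht : 0 ≤ t) (x : Fin n → ℕ) :
    evol Λ d t (fun y => total y) x ≤ ENNReal.ofReal (Real.exp (-t)) * total x +
      ENNReal.ofReal (Λ * (1 - Real.exp (-t))) := by
  have hΛ : 0 < Λ := Fact.out
  refine lintegral_le_of_forall_min ?_ fun B => ?_
  · exact (Measurable.of_discrete (f := total)).comp (measurable_loadAt_noise t x)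
  refine le_of_first_step (Λ := Λ) (d := d) (n := n)
    (F := fun t x => evol Λ d t (fun y => (min (total y) B : ℕ)) x)
    (G := fun t x => ENNReal.ofReal (Real.exp (-t)) * total x +
      ENNReal.ofReal (Λ * (1 - Real.exp (-t))))
    (a := fun t s x => (min (total (thin t s.2 x)) B : ℕ))
    (φ := next) (ENNReal.natCast_ne_top B) (fun t p => ?_)
    (fun t _ x => (evol_first_step t _ x).le) (fun t ht x => ?_) ht x
  · refine (lintegral_mono (g := fun _ => (B : ℝ≥0∞)) fun θ => ?_).trans ?_
    · exact Nat.cast_le.2 (min_le_right _ _)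
    · simp
  · have hT : Measurable fun y : Fin n → ℕ => (total y : ℝ≥0∞) := Measurable.of_discrete
    have hmt : Measurable fun q : Step d n => (total (thin (min t q.1.1) q.2 x) : ℝ≥0∞) :=
      hT.comp (measurable_thin_comp (by fun_prop) (by fun_prop) (by fun_prop))
    set e : ℝ → ℝ≥0∞ := fun g => if t < g then 1 else ENNReal.ofReal (Real.exp (-(t - g))) with he
    -- The contribution of the first arriving ball and its successors; `e` carries that of the
    -- initial balls.
    set c : ℝ → ℝ≥0∞ := (Set.Iic t).indicator fun g => ENNReal.ofReal (Real.exp (-(t - g))) +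
      ENNReal.ofReal (Λ * (1 - Real.exp (-(t - g)))) with hc
    have hem : Measurable e := Measurable.ite (measurableSet_lt (by fun_prop) (by fun_prop))
      (by fun_prop) (by fun_prop)
    have hcm : Measurable c := Measurable.indicator (by fun_prop) measurableSet_Iic
    have hle : ∀ s : Step d n, (if t < s.1.1 then
          ((min (total (thin t s.2 x)) B : ℕ) : ℝ≥0∞) else
          ENNReal.ofReal (Real.exp (-(t - s.1.1))) * total (next s x) +
            ENNReal.ofReal (Λ * (1 - Real.exp (-(t - s.1.1))))) ≤
        e s.1.1 * total (thin (min t s.1.1) s.2 x) + c s.1.1 := by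
      intro s
      simp only [he, hc]
      split_ifs with h
      · rw [min_eq_left h.le, one_mul]
        exact le_add_right (Nat.cast_le.2 (min_le_left _ _))
      · rw [min_eq_right (not_lt.1 h), Set.indicator_of_mem (show s.1.1 ∈ Set.Iic t from not_lt.1 h),
          next, total_place, Nat.cast_add, Nat.cast_one, mul_add, mul_one, add_assoc]
    have hm1 : Measurable fun s : Step d n => e s.1.1 * total (thin (min t s.1.1) s.2 x) :=
      Measurable.mul (hem.comp (by fun_prop)) hmt
    refine (lintegral_mono hle).trans ?_
    rw [lintegral_add_left hm1]
    refine add_le_add ?_ (le_of_eq ?_)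
    · rw [lintegral_prod _ hm1.aemeasurable]
      have hpos : ∀ᵐ m ∂((expMeasure Λ).prod (uniformOn (Set.univ : Set (Fin d → Fin n)))),
          0 < m.1 := Measure.quasiMeasurePreserving_fst.ae (expMeasure_ae_pos Fact.out)
      refine (lintegral_mono_ae (g := fun _ => ENNReal.ofReal (Real.exp (-t)) * total x)
        ?_).trans (by simp)
      filter_upwards [hpos] with m hm
      have hm' : Measurable fun ξ : Fin n × ℕ → ℝ =>
          (total (thin (min t m.1) ξ x) : ℝ≥0∞) :=
        hT.comp (measurable_thin_right _ _)
      refine (lintegral_const_mul _ hm').trans_le ?_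
      rw [lintegral_total_thin (le_min ht hm.le), ← mul_assoc]
      gcongr
      simp only [he]
      split_ifs with h
      · rw [min_eq_left h.le, one_mul]
      · rw [min_eq_right (not_lt.1 h), ← ENNReal.ofReal_mul (by positivity), ← Real.exp_add]
        ring_nf
        exact le_rfl
    · rw [lintegral_stepLaw (F := fun s => c s.1.1) (hcm.comp (by fun_prop))]
      simp only [lintegral_const, measure_univ, mul_one, hc]
      rw [lintegral_indicator measurableSet_Iic, setLIntegral_expMeasure_mean ht]

end BallsBins

end

/-! ### From one lifetime per ball to fresh lifetimes after each arrival. -/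

noncomputable section

namespace BallsBins

set_option linter.unusedSectionVars false

variable {d n : ℕ} [NeZero d]

/-! ### The load vector after a given number of arrivals -/

/-- The load vector at time `t`, if the first `m` balls are taken into account. -/
def loadAfter (m : ℕ) (t : ℝ) (u : Input d n) : Fin n → ℕ := fun j =>
  u.initAlive t j +
    ((Finset.range m).filter fun k => u.bin k = j ∧ t < u.arrival k + u.life k).card

theorem bin_eq (u : Input d n) (k : ℕ) :
    u.bin k = leastLoaded (u.choice k) (loadAfter k (u.arrival k) u) := by
  rw [Input.bin]
  congr 1
  funext j
  rw [loadAfter]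
  congr 1
  simp only [Finset.card_filter]
  exact Fin.sum_univ_eq_sum_range
    (fun m => if u.bin m = j ∧ u.arrival k < u.arrival m + u.life m then 1 else 0) k

theorem measurable_arrival (k : ℕ) : Measurable fun u : Input d n => u.arrival k := by
  unfold Input.arrival; fun_prop

theorem measurable_loadAfter_of_bin {m : ℕ} (h : ∀ k < m, Measurable fun u : Input d n => u.bin k)
    {r : Input d n → ℝ} (hr : Measurable r) :
    Measurable fun u : Input d n => loadAfter m (r u) u := by
  refine measurable_pi_iff.2 fun j => Measurable.add ?_ ?_
  · exact (measurable_pi_apply j).comp (measurable_thin_comp (s := r)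
      (ξ := fun u : Input d n => u.initLife) (x := fun u : Input d n => u.init) hr
      (by fun_prop) (by fun_prop))
  · refine measurable_card_filter _ fun k hk => ?_
    exact (h k (Finset.mem_range.1 hk) (measurableSet_singleton j)).inter
      (measurableSet_lt hr ((measurable_arrival k).add (by fun_prop)))

theorem measurable_bin (k : ℕ) : Measurable fun u : Input d n => u.bin k := by
  induction k using Nat.strong_induction_on with
  | _ k ih =>
    have h1 := measurable_loadAfter_of_bin ih (measurable_arrival k)
    have h2 : Measurable fun q : (Fin d → Fin n) × (Fin n → ℕ) => leastLoaded q.1 q.2 :=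
      Measurable.of_discrete
    have h3 : Measurable fun u : Input d n => u.choice k := by fun_prop
    rw [show (fun u : Input d n => u.bin k) = fun u : Input d n =>
      leastLoaded (u.choice k) (loadAfter k (u.arrival k) u) from funext fun u => bin_eq u k]
    exact h2.comp (h3.prodMk h1)

theorem measurable_loadAfter (m : ℕ) (t : ℝ) :
    Measurable fun u : Input d n => loadAfter m t u :=
  measurable_loadAfter_of_bin (fun k _ => measurable_bin k) measurable_const

/-- The load vector at time `t`, with arrivals counted by `arrivalCount`. -/
def countedLoad (t : ℝ) (u : Input d n) : Fin n → ℕ := loadAfter (arrivalCount u.gap t) t u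

theorem measurable_countedLoad (t : ℝ) : Measurable fun u : Input d n => countedLoad t u := by
  have h1 : Measurable fun q : ℕ × Input d n => loadAfter q.1 t q.2 :=
    measurable_from_prod_countable_right fun m => measurable_loadAfter m t
  have h2 : Measurable fun u : Input d n => arrivalCount u.gap t :=
    measurable_arrivalCount.comp (f := fun u : Input d n => (t, u.gap)) (by fun_prop)
  exact h1.comp (h2.prodMk measurable_id)

theorem strictMono_arrivalTime {g : ℕ → ℝ} (hg : ∀ k, 0 < g k) : StrictMono (arrivalTime g) :=
  strictMono_nat_of_lt_succ fun k => by rw [arrivalTime_succ]; linarith [hg (k + 1)]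

theorem lt_arrivalCount_iff {g : ℕ → ℝ} (hg : ∀ k, 0 < g k) {t : ℝ}
    (h : ∃ m, t < arrivalTime g m) {k : ℕ} : k < arrivalCount g t ↔ arrivalTime g k ≤ t := by
  constructor
  · intro hk
    exact not_lt.1 fun hk' => Nat.notMem_of_lt_sInf hk hk'
  · intro hk
    have : t < arrivalTime g (arrivalCount g t) := Nat.sInf_mem h
    exact (strictMono_arrivalTime hg).lt_iff_lt.1 (hk.trans_lt this)

/-- With positive waiting times, the balls arrived by `t` are an initial segment of the numbering,
and it is finite because some arrival is later than `t`. -/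
theorem load_eq_countedLoad {u : Input d n} (hg : ∀ k, 0 < u.gap k) {t : ℝ}
    (h : ∃ m, t < arrivalTime u.gap m) : u.load t = countedLoad t u := by
  funext j
  rw [Input.load, countedLoad, loadAfter]
  congr 1
  rw [← Set.ncard_coe_finset]
  congr 1
  ext k
  simp only [Finset.coe_filter, Finset.mem_range, lt_arrivalCount_iff hg h]
  rfl

/-! ### Resampling the residual lifetimes after an arrival -/

/-- The input with all lifetimes in one family. -/
def mkInput (x : Fin n → ℕ) (g : ℕ → ℝ) (c : ℕ → Fin d → Fin n) (L : (Fin n × ℕ) ⊕ ℕ → ℝ) :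
    Input d n :=
  (x, fun p => L (.inl p), g, c, fun k => L (.inr k))

theorem measurable_mkInput (x : Fin n → ℕ) (g : ℕ → ℝ) (c : ℕ → Fin d → Fin n) :
    Measurable fun L => mkInput x g c L := by
  unfold mkInput; fun_prop

/-- The age at time `s` of the balls, initial ones and arriving ones. -/
def age (g : ℕ → ℝ) (s : ℝ) : (Fin n × ℕ) ⊕ ℕ → ℝ :=
  Sum.elim (fun _ => s) fun k => max 0 (s - arrivalTime g k)

/-- Resampling alters only lifetimes of balls alive past time `s`, and keeps them alive past `s`; no
event up to `s` is affected. -/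
theorem lt_resample_age_inr_iff {g : ℕ → ℝ} {s r : ℝ} (hr : r ≤ s)
    {L L' : (Fin n × ℕ) ⊕ ℕ → ℝ} (hL' : ∀ i, 0 < L' i) (k : ℕ) :
    r < arrivalTime g k + resample (age g s) L L' (.inr k) ↔ r < arrivalTime g k + L (.inr k) := by
  have h := hL' (.inr k)
  have h1 := le_max_right 0 (s - arrivalTime g k)
  change r < arrivalTime g k + (if max 0 (s - arrivalTime g k) < L (.inr k) then
    max 0 (s - arrivalTime g k) + L' (.inr k) else L (.inr k)) ↔ _
  by_cases hk : max 0 (s - arrivalTime g k) < L (.inr k)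
  · rw [if_pos hk]
    constructor <;> intro <;> linarith
  · rw [if_neg hk]

theorem lt_resample_age_inl_iff {g : ℕ → ℝ} {s r : ℝ} (hr : r ≤ s)
    {L L' : (Fin n × ℕ) ⊕ ℕ → ℝ} (hL' : ∀ i, 0 < L' i) (p : Fin n × ℕ) :
    r < resample (age g s) L L' (.inl p) ↔ r < L (.inl p) := by
  have h := hL' (.inl p)
  change r < (if s < L (.inl p) then s + L' (.inl p) else L (.inl p)) ↔ _
  by_cases hk : s < L (.inl p)
  · rw [if_pos hk]
    constructor <;> intro <;> linarith
  · rw [if_neg hk]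

/-- A ball arriving by time `s` sees loads that depend only on departures up to `s` and on the bins
of earlier balls. This is the hypothesis that `lintegral_survivors_add` places on the bins. -/
theorem bin_resample_age {x : Fin n → ℕ} {g : ℕ → ℝ} (hg : ∀ k, 0 < g k)
    {c : ℕ → Fin d → Fin n} {s : ℝ} {L L' : (Fin n × ℕ) ⊕ ℕ → ℝ} (hL' : ∀ i, 0 < L' i) (k : ℕ)
    (hk : arrivalTime g k ≤ s) :
    (mkInput x g c (resample (age g s) L L')).bin k = (mkInput x g c L).bin k := by
  induction k using Nat.strong_induction_on with
  | _ k ih =>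
    rw [bin_eq, bin_eq]
    change leastLoaded (c k) (loadAfter k (arrivalTime g k) _) =
      leastLoaded (c k) (loadAfter k (arrivalTime g k) _)
    congr 1
    funext j
    simp only [loadAfter, Input.initAlive]
    congr 1
    · exact congrArg Finset.card (Finset.filter_congr fun i _ =>
        lt_resample_age_inl_iff hk hL' (j, i))
    · refine congrArg Finset.card (Finset.filter_congr fun m hm => ?_)
      have hm := Finset.mem_range.1 hm
      rw [ih m hm (((strictMono_arrivalTime hg).monotone hm.le).trans hk)]
      exact and_congr Iff.rfl (lt_resample_age_inr_iff hk hL' m)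

/-- The balls present initially or among the first `m` arrivals. -/
def ballSet (x : Fin n → ℕ) (m : ℕ) : Finset ((Fin n × ℕ) ⊕ ℕ) :=
  (Finset.univ.biUnion fun j => (Finset.range (x j)).image (Prod.mk j)).disjSum (Finset.range m)

/-- The bin of each ball. -/
def ballBin (x : Fin n → ℕ) (g : ℕ → ℝ) (c : ℕ → Fin d → Fin n) (L : (Fin n × ℕ) ⊕ ℕ → ℝ) :
    (Fin n × ℕ) ⊕ ℕ → Fin n :=
  Sum.elim Prod.fst fun k => (mkInput x g c L).bin k

theorem card_filter_ballSet (x : Fin n → ℕ) (m : ℕ) (p : (Fin n × ℕ) ⊕ ℕ → Prop) [DecidablePred p]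
    (b : ℕ → Fin n) (j : Fin n) :
    ((ballSet x m).filter fun i => Sum.elim Prod.fst b i = j ∧ p i).card =
      ((Finset.range (x j)).filter fun i => p (.inl (j, i))).card +
      ((Finset.range m).filter fun k => b k = j ∧ p (.inr k)).card := by
  classical
  have h : (ballSet x m).filter (fun i => Sum.elim Prod.fst b i = j ∧ p i) =
      (((Finset.range (x j)).filter fun i => p (.inl (j, i))).image (Prod.mk j)).disjSum
        ((Finset.range m).filter fun k => b k = j ∧ p (.inr k)) := by
    ext (⟨j', i⟩ | k)
    · simp only [ballSet, Finset.mem_filter, Finset.inl_mem_disjSum, Finset.mem_biUnion,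
        Finset.mem_univ, true_and, Finset.mem_image, Finset.mem_range, Prod.mk.injEq,
        Sum.elim_inl]
      constructor
      · rintro ⟨⟨_, i', hi', rfl, rfl⟩, rfl, h⟩
        exact ⟨i', ⟨hi', h⟩, rfl, rfl⟩
      · rintro ⟨i', ⟨hi', h⟩, rfl, rfl⟩
        exact ⟨⟨j, i', hi', rfl, rfl⟩, rfl, h⟩
    · simp [ballSet]
  rw [h, Finset.card_disjSum, Finset.card_image_of_injective _ (Prod.mk_right_injective j)]

theorem loadAfter_mkInput_zero (t : ℝ) (x : Fin n → ℕ) (g : ℕ → ℝ) (c : ℕ → Fin d → Fin n)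
    (L : (Fin n × ℕ) ⊕ ℕ → ℝ) :
    loadAfter 0 t (mkInput x g c L) = thin t (fun p => L (.inl p)) x := by
  funext j
  rfl

/-- The load vector after arrival `m`, given the one that ball `m` sees. -/
theorem lintegral_loadAfter_succ {x : Fin n → ℕ} {g : ℕ → ℝ} (hg : ∀ k, 0 < g k)
    {c : ℕ → Fin d → Fin n} {m : ℕ} {t : ℝ} (ht : arrivalTime g m ≤ t)
    (f : (Fin n → ℕ) → ℝ≥0∞) :
    ∫⁻ L, f (loadAfter (m + 1) t (mkInput x g c L)) ∂lifeLaw ((Fin n × ℕ) ⊕ ℕ) =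
      ∫⁻ L, ∫⁻ ξ, f (thin (t - arrivalTime g m) ξ
        (place (c m) (loadAfter m (arrivalTime g m) (mkInput x g c L))))
        ∂lifeLaw (Fin n × ℕ) ∂lifeLaw ((Fin n × ℕ) ⊕ ℕ) := by
  set s := arrivalTime g m with hs
  have hmono := (strictMono_arrivalTime hg).monotone
  have hs0 : 0 ≤ s := by
    refine le_trans ?_ (hmono (Nat.zero_le m))
    rw [arrivalTime_zero]
    exact (hg 0).le
  -- Time is split at arrival `m`. The truncation at `0` in `age` serves to make every age
  -- nonnegative; it is inactive for the balls in `ballSet x (m + 1)`.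
  have key := lintegral_survivors_add (ballSet x (m + 1)) (α := age g s) (r := t - s)
    (by rintro (i | k) <;> simp [age, hs0]) (by linarith) (β := ballBin x g c)
    (by
      rintro (i | k) -
      · exact measurable_const
      · exact (measurable_bin k).comp (measurable_mkInput x g c))
    (by
      rintro L L' hL' (i | k) hi
      · rfl
      · have hk : k ≤ m := by simpa [ballSet, Nat.lt_succ_iff] using hi
        exact bin_resample_age hg hL' k (hmono hk)) f
  have e1 : ∀ L, (fun j => ((ballSet x (m + 1)).filter fun i =>
      ballBin x g c L i = j ∧ age g s i + (t - s) < L i).card) =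
      loadAfter (m + 1) t (mkInput x g c L) := by
    intro L
    funext j
    unfold ballBin
    rw [card_filter_ballSet, loadAfter, Input.initAlive]
    congr 1
    · refine congrArg Finset.card (Finset.filter_congr fun i _ => ?_)
      simp [age, mkInput]
    · refine congrArg Finset.card (Finset.filter_congr fun k hk => ?_)
      have hk : arrivalTime g k ≤ s := hmono (Nat.lt_succ_iff.1 (Finset.mem_range.1 hk))
      refine and_congr Iff.rfl ?_
      change max 0 (s - arrivalTime g k) + (t - s) < L (.inr k) ↔
        t < arrivalTime g k + L (.inr k)
      rw [max_eq_right (by linarith)]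
      constructor <;> intro <;> linarith
  have e2 : ∀ᵐ L ∂lifeLaw ((Fin n × ℕ) ⊕ ℕ), (fun j => ((ballSet x (m + 1)).filter fun i =>
      ballBin x g c L i = j ∧ age g s i < L i).card) =
      place (c m) (loadAfter m s (mkInput x g c L)) := by
    filter_upwards [ae_infinitePi_eval (ι := (Fin n × ℕ) ⊕ ℕ) _ (expMeasure_ae_pos one_pos)]
      with L hL
    funext j
    unfold ballBin
    have hin : ∀ k ∈ Finset.range m, (((mkInput x g c L).bin k = j ∧ age (n := n) g s (.inr k) < L (.inr k)) ↔
        ((mkInput x g c L).bin k = j ∧ s < (mkInput x g c L).arrival k + (mkInput x g c L).life k)) := by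
      intro k hk
      have hk : arrivalTime g k ≤ s := hmono (Finset.mem_range.1 hk).le
      refine and_congr Iff.rfl ?_
      change max 0 (s - arrivalTime g k) < L (.inr k) ↔ s < arrivalTime g k + L (.inr k)
      rw [max_eq_right (by linarith)]
      constructor <;> intro <;> linarith
    rw [card_filter_ballSet, place, loadAfter, Input.initAlive, add_assoc]
    congr 1
    rw [Finset.range_add_one, Finset.filter_insert, Finset.filter_congr hin]
    -- Ball `m` arrives exactly at `s`, so it has age `0` and is alive: it is the unit added by
    -- `place`.
    have hm : age (n := n) g s (.inr m) < L (.inr m) := by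
      simp [age, ← hs, hL]
    have hb : (mkInput x g c L).bin m = leastLoaded (c m) (loadAfter m s (mkInput x g c L)) :=
      bin_eq _ _
    rw [hb]
    split_ifs with h1 h2 h2
    · rw [Finset.card_insert_of_notMem (by simp)]
    · exact absurd h1.1 h2
    · exact absurd ⟨h2, hm⟩ h1
    · rfl
  simp only [e1] at key
  rw [key]
  refine lintegral_congr_ae ?_
  filter_upwards [e2] with L hL
  rw [hL]

/-! ### Comparison with fresh lifetimes after each arrival -/

/-- The steps with given waiting times, choices and lifetimes. -/
def mkNoise (g : ℕ → ℝ) (c : ℕ → Fin d → Fin n) (ξ : ℕ → Fin n × ℕ → ℝ) : ℕ → Step d n :=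
  fun k => ((g k, c k), ξ k)

theorem measurable_mkNoise (g : ℕ → ℝ) (c : ℕ → Fin d → Fin n) :
    Measurable fun ξ => mkNoise g c ξ := by
  unfold mkNoise; fun_prop

/-- The expectation of `f` after `m` arrivals, for given waiting times and choices. -/
def runMean (m : ℕ) (t : ℝ) (f : (Fin n → ℕ) → ℝ≥0∞) (x : Fin n → ℕ) (g : ℕ → ℝ)
    (c : ℕ → Fin d → Fin n) : ℝ≥0∞ :=
  ∫⁻ ξ, f (run m t (mkNoise g c ξ) x) ∂(Measure.infinitePi fun _ : ℕ => lifeLaw (Fin n × ℕ))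

theorem runMean_zero (t : ℝ) (f : (Fin n → ℕ) → ℝ≥0∞) (x : Fin n → ℕ) (g : ℕ → ℝ)
    (c : ℕ → Fin d → Fin n) :
    runMean 0 t f x g c = ∫⁻ ξ, f (thin t ξ x) ∂lifeLaw (Fin n × ℕ) := by
  conv_rhs => rw [← Measure.infinitePi_map_eval (fun _ : ℕ => lifeLaw (Fin n × ℕ)) 0]
  exact (lintegral_map (f := fun ξ => f (thin t ξ x))
    ((Measurable.of_discrete (f := f)).comp (measurable_thin_right t x))
    (measurable_pi_apply 0)).symm

theorem runMean_succ (m : ℕ) (t : ℝ) (f : (Fin n → ℕ) → ℝ≥0∞) (x : Fin n → ℕ) (g : ℕ → ℝ)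
    (c : ℕ → Fin d → Fin n) :
    runMean (m + 1) t f x g c = ∫⁻ ξ, runMean m (t - g 0) f (next ((g 0, c 0), ξ) x)
      (fun k => g (k + 1)) (fun k => c (k + 1)) ∂lifeLaw (Fin n × ℕ) := by
  have hm : Measurable fun ξ : ℕ → Fin n × ℕ → ℝ => f (run (m + 1) t (mkNoise g c ξ) x) :=
    (Measurable.of_discrete (f := f)).comp ((measurable_run (m + 1)).comp
      (measurable_const.prodMk ((measurable_mkNoise g c).prodMk measurable_const)))
  rw [runMean, lintegral_infinitePi_succ _ hm]
  rfl

/-- The recursion of `run` removes the first arrival, whereas `lintegral_loadAfter_succ` removes the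
last. This form makes the two models comparable by induction. -/
theorem runMean_last (m : ℕ) (t : ℝ) (f : (Fin n → ℕ) → ℝ≥0∞) (x : Fin n → ℕ) (g : ℕ → ℝ)
    (c : ℕ → Fin d → Fin n) :
    runMean (m + 1) t f x g c = runMean m (arrivalTime g m) (fun y =>
      ∫⁻ ξ, f (thin (t - arrivalTime g m) ξ (place (c m) y)) ∂lifeLaw (Fin n × ℕ)) x g c := by
  induction m generalizing t x g c with
  | zero =>
    rw [runMean_succ, runMean_zero]
    simp only [runMean_zero, next, arrivalTime_zero]
  | succ m ih =>
    rw [runMean_succ, runMean_succ]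
    refine lintegral_congr fun ξ => ?_
    rw [ih, arrivalTime_succ', add_sub_cancel_left, sub_add_eq_sub_sub]

/-- Equality in law of the two models for given waiting times and choices: both satisfy the same
last-arrival recursion. The induction varies `f`, which absorbs the evolution after the last
arrival. -/
theorem lintegral_loadAfter {g : ℕ → ℝ} (hg : ∀ k, 0 < g k) (x : Fin n → ℕ)
    (c : ℕ → Fin d → Fin n) {m : ℕ} {t : ℝ} (ht : ∀ k < m, arrivalTime g k ≤ t)
    (f : (Fin n → ℕ) → ℝ≥0∞) :
    ∫⁻ L, f (loadAfter m t (mkInput x g c L)) ∂lifeLaw ((Fin n × ℕ) ⊕ ℕ) =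
      runMean m t f x g c := by
  induction m generalizing t f with
  | zero =>
    simp only [loadAfter_mkInput_zero]
    have h := Measure.map_infinitePi_infinitePi_of_inj
      (P := fun _ : (Fin n × ℕ) ⊕ ℕ => expMeasure 1) (f := Sum.inl) Sum.inl_injective
    rw [runMean_zero]
    conv_rhs => rw [lifeLaw, ← h]
    exact (lintegral_map (f := fun ξ => f (thin t ξ x))
      ((Measurable.of_discrete (f := f)).comp (measurable_thin_right t x)) (by fun_prop)).symm
  | succ m ih =>
    rw [lintegral_loadAfter_succ hg (ht m (Nat.lt_succ_self m)), runMean_last]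
    exact ih (fun k hk => (strictMono_arrivalTime hg).monotone hk.le) fun y =>
      ∫⁻ ξ, f (thin (t - arrivalTime g m) ξ (place (c m) y)) ∂lifeLaw (Fin n × ℕ)

end BallsBins

end

/-! ### Transfer of the law to the original dynamics. -/

noncomputable section

namespace BallsBins

set_option linter.unusedSectionVars false

variable {d n : ℕ} [NeZero d] [NeZero n] {Λ : ℝ} [Fact (0 < Λ)]

/-! ### The law of the load vector -/

/-- The expectation with respect to fresh lifetimes, for given waiting times and choices. -/
theorem evol_eq_lintegral_runMean (t : ℝ) (f : (Fin n → ℕ) → ℝ≥0∞) (x : Fin n → ℕ) :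
    evol Λ d t f x = ∫⁻ g, ∫⁻ c, runMean (arrivalCount g t) t f x g c
      ∂(Measure.infinitePi fun _ : ℕ => uniformOn (Set.univ : Set (Fin d → Fin n)))
      ∂(Measure.infinitePi fun _ : ℕ => expMeasure Λ) := by
  have h1 : Measurable fun θ : ℕ → Step d n => f (loadAt t θ x) :=
    (Measurable.of_discrete (f := f)).comp (measurable_loadAt_noise t x)
  have h2 : Measurable fun e : ℕ → ℝ × (Fin d → Fin n) =>
      ∫⁻ ξ, f (loadAt t (fun i => (e i, ξ i)) x)
        ∂(Measure.infinitePi fun _ : ℕ => lifeLaw (Fin n × ℕ)) :=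
    Measurable.lintegral_prod_right' (f := fun q : (ℕ → ℝ × (Fin d → Fin n)) ×
      (ℕ → Fin n × ℕ → ℝ) => f (loadAt t (fun i => (q.1 i, q.2 i)) x)) (h1.comp (by fun_prop))
  rw [evol, lintegral_infinitePi_zip _ _ h1, lintegral_infinitePi_zip _ _ h2]
  rfl

/-- The law at time `t` if the initial law is `ν`. -/
def lawAt (Λ : ℝ) (d : ℕ) [NeZero d] (t : ℝ) (ν : Measure (Fin n → ℕ)) : Measure (Fin n → ℕ) :=
  (ν.prod (noiseLaw Λ d n)).map fun p => loadAt t p.2 p.1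

theorem measurable_loadAt_swap (t : ℝ) :
    Measurable fun p : (Fin n → ℕ) × (ℕ → Step d n) => loadAt t p.2 p.1 :=
  measurable_loadAt.comp
    (f := fun p : (Fin n → ℕ) × (ℕ → Step d n) => (t, p.2, p.1)) (by fun_prop)

theorem lintegral_lawAt (t : ℝ) (ν : Measure (Fin n → ℕ)) (f : (Fin n → ℕ) → ℝ≥0∞) :
    ∫⁻ y, f y ∂(lawAt Λ d t ν) = ∫⁻ x, evol Λ d t f x ∂ν := by
  have hf : Measurable f := Measurable.of_discrete
  rw [lawAt, lintegral_map hf (measurable_loadAt_swap t)]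
  exact lintegral_prod _ (hf.comp (measurable_loadAt_swap t)).aemeasurable

instance isProbabilityMeasure_lawAt (t : ℝ) (ν : Measure (Fin n → ℕ)) [IsProbabilityMeasure ν] :
    IsProbabilityMeasure (lawAt Λ d t ν) :=
  Measure.isProbabilityMeasure_map (measurable_loadAt_swap t).aemeasurable

theorem ae_gap_pos : ∀ᵐ g ∂(Measure.infinitePi fun _ : ℕ => expMeasure Λ), ∀ k, 0 < g k :=
  ae_infinitePi_eval _ (expMeasure_ae_pos Fact.out)

variable {lam : ℝ} [Fact (0 < lam * n)]

theorem ae_load_eq_countedLoad (ν : Measure (Fin n → ℕ)) [IsProbabilityMeasure ν] :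
    ∀ᵐ u ∂(inputLaw lam d n ν), ∀ t, u.load t = countedLoad t u := by
  have h : ∀ᵐ u ∂(inputLaw lam d n ν), (∀ k, 0 < u.gap k) ∧ ∀ t, ∃ m, t < arrivalTime u.gap m :=
    Measure.quasiMeasurePreserving_snd.ae (Measure.quasiMeasurePreserving_snd.ae
      (Measure.quasiMeasurePreserving_fst.ae (ae_gap_pos.and ae_exists_lt_arrivalTime)))
  filter_upwards [h] with u hu t
  exact load_eq_countedLoad hu.1 (hu.2 t)

/-- Fubini brings the lifetimes innermost. Once the waiting times are fixed, so is the number of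
arrivals, and `lintegral_loadAfter` applies. -/
theorem lintegral_countedLoad (t : ℝ) (ν : Measure (Fin n → ℕ)) [IsProbabilityMeasure ν]
    (f : (Fin n → ℕ) → ℝ≥0∞) :
    ∫⁻ u, f (countedLoad t u) ∂(inputLaw lam d n ν) = ∫⁻ x, evol (lam * n) d t f x ∂ν := by
  have hf : Measurable fun u : Input d n => f (countedLoad t u) :=
    (Measurable.of_discrete (f := f)).comp (measurable_countedLoad t)
  rw [inputLaw, lintegral_prod _ hf.aemeasurable]
  refine lintegral_congr fun x => ?_
  have hx : Measurable fun v : (Fin n × ℕ → ℝ) × (ℕ → ℝ) × (ℕ → Fin d → Fin n) × (ℕ → ℝ) =>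
      f (countedLoad t (x, v)) := hf.comp (by fun_prop)
  have hxb : Measurable fun q : ((Fin n × ℕ → ℝ) × (ℕ → ℝ)) × (ℕ → Fin d → Fin n) =>
      ∫⁻ b, f (countedLoad t (x, q.1.1, q.1.2, q.2, b))
        ∂(Measure.infinitePi fun _ : ℕ => expMeasure 1) :=
    Measurable.lintegral_prod_right' (f := fun q : (((Fin n × ℕ → ℝ) × (ℕ → ℝ)) ×
      (ℕ → Fin d → Fin n)) × (ℕ → ℝ) => f (countedLoad t (x, q.1.1.1, q.1.1.2, q.1.2, q.2)))
      (hx.comp (by fun_prop))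
  have hxc : Measurable fun q : (Fin n × ℕ → ℝ) × (ℕ → ℝ) =>
      ∫⁻ c, ∫⁻ b, f (countedLoad t (x, q.1, q.2, c, b))
        ∂(Measure.infinitePi fun _ : ℕ => expMeasure 1)
        ∂(Measure.infinitePi fun _ : ℕ => uniformOn (Set.univ : Set (Fin d → Fin n))) :=
    Measurable.lintegral_prod_right' hxb
  rw [lintegral_prod _ hx.aemeasurable]
  have e1 : ∀ a : Fin n × ℕ → ℝ, ∫⁻ v, f (countedLoad t (x, a, v))
      ∂((Measure.infinitePi fun _ : ℕ => expMeasure (lam * n)).prod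
        ((Measure.infinitePi fun _ : ℕ => uniformOn (Set.univ : Set (Fin d → Fin n))).prod
          (Measure.infinitePi fun _ : ℕ => expMeasure 1))) =
      ∫⁻ g, ∫⁻ c, ∫⁻ b, f (countedLoad t (x, a, g, c, b))
        ∂(Measure.infinitePi fun _ : ℕ => expMeasure 1)
        ∂(Measure.infinitePi fun _ : ℕ => uniformOn (Set.univ : Set (Fin d → Fin n)))
        ∂(Measure.infinitePi fun _ : ℕ => expMeasure (lam * n)) := by
    intro a
    have ha : Measurable fun v : (ℕ → ℝ) × (ℕ → Fin d → Fin n) × (ℕ → ℝ) =>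
      f (countedLoad t (x, a, v)) := hx.comp (by fun_prop)
    rw [lintegral_prod _ ha.aemeasurable]
    refine lintegral_congr fun g => ?_
    have hg : Measurable fun v : (ℕ → Fin d → Fin n) × (ℕ → ℝ) =>
      f (countedLoad t (x, a, g, v)) := ha.comp (by fun_prop)
    exact lintegral_prod _ hg.aemeasurable
  simp_rw [e1]
  rw [lintegral_lintegral_swap hxc.aemeasurable, evol_eq_lintegral_runMean]
  refine lintegral_congr_ae ?_
  filter_upwards [ae_gap_pos, ae_exists_lt_arrivalTime] with g hg1 hg2
  have hxg : Measurable fun q : (Fin n × ℕ → ℝ) × (ℕ → Fin d → Fin n) =>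
      ∫⁻ b, f (countedLoad t (x, q.1, g, q.2, b))
        ∂(Measure.infinitePi fun _ : ℕ => expMeasure 1) :=
    hxb.comp (f := fun q : (Fin n × ℕ → ℝ) × (ℕ → Fin d → Fin n) => ((q.1, g), q.2)) (by fun_prop)
  rw [lintegral_lintegral_swap hxg.aemeasurable]
  refine lintegral_congr fun c => ?_
  have hL : Measurable fun L : (Fin n × ℕ) ⊕ ℕ → ℝ => f (countedLoad t (mkInput x g c L)) :=
    hf.comp (measurable_mkInput x g c)
  have h := lintegral_infinitePi_sum (expMeasure 1) hL
  refine h.symm.trans ?_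
  exact lintegral_loadAfter hg1 x c (fun k hk => (lt_arrivalCount_iff hg1 (hg2 t)).1 hk) f

/-- The law of the load vector at time `t`. -/
theorem hasLaw_load (t : ℝ) (ν : Measure (Fin n → ℕ)) [IsProbabilityMeasure ν] :
    HasLaw (fun u : Input d n => u.load t) (lawAt (lam * n) d t ν) (inputLaw lam d n ν) := by
  have hae : (fun u : Input d n => u.load t) =ᵐ[inputLaw lam d n ν] countedLoad t :=
    (ae_load_eq_countedLoad ν).mono fun u hu => hu t
  have hm : Measurable fun u : Input d n => countedLoad t u := measurable_countedLoad t
  refine HasLaw.congr ⟨hm.aemeasurable, ?_⟩ hae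
  refine Measure.ext_of_lintegral _ fun f hf => ?_
  rw [lintegral_map hf hm, lintegral_countedLoad, lintegral_lawAt]

theorem isStationary_iff {π : Measure (Fin n → ℕ)} : IsStationary lam d n π ↔
    IsProbabilityMeasure π ∧ ∀ t, 0 ≤ t → lawAt (lam * n) d t π = π := by
  refine and_congr_right fun hπ => forall₂_congr fun t _ => ?_
  refine ⟨fun h => ?_, fun h => ?_⟩
  · rw [← (hasLaw_load t π).map_eq, h.map_eq]
  · have h' := hasLaw_load (lam := lam) (d := d) t π
    rwa [h] at h'

end BallsBins

end

/-! ### Existence and uniqueness of the stationary law, and the distance bounds. -/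

noncomputable section

namespace BallsBins

set_option linter.unusedSectionVars false

open Filter Topology

variable {d n : ℕ} [NeZero d] [NeZero n] {Λ : ℝ} [Fact (0 < Λ)]

/-! ### Dependence on the initial load vector -/

theorem evol_mono (t : ℝ) {f g : (Fin n → ℕ) → ℝ≥0∞} (h : ∀ x, f x ≤ g x) (x : Fin n → ℕ) :
    evol Λ d t f x ≤ evol Λ d t g x :=
  lintegral_mono fun _ => h _

theorem evol_const (t : ℝ) (c : ℝ≥0∞) (x : Fin n → ℕ) : evol Λ d t (fun _ => c) x = c := by
  simp [evol]

theorem evol_le_one (t : ℝ) {f : (Fin n → ℕ) → ℝ≥0∞} (h : ∀ x, f x ≤ 1) (x : Fin n → ℕ) :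
    evol Λ d t f x ≤ 1 :=
  (evol_mono t h x).trans_eq (evol_const t 1 x)

/-- Under shared noise the values of `f` differ only when the two load vectors do; the excess is
then at most `1`, hence at most their distance. -/
theorem evol_le_evol_add {t : ℝ} (ht : 0 ≤ t) {f : (Fin n → ℕ) → ℝ≥0∞} (hf : ∀ x, f x ≤ 1)
    (x y : Fin n → ℕ) :
    evol Λ d t f x ≤ evol Λ d t f y + ENNReal.ofReal (Real.exp (-t)) * l1Dist x y := by
  have hm : Measurable fun θ : ℕ → Step d n => f (loadAt t θ y) :=
    (Measurable.of_discrete (f := f)).comp (measurable_loadAt_noise t y)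
  refine le_trans ?_ (add_le_add_right (lintegral_l1Dist_loadAt_le (Λ := Λ) (d := d) ht x y) _)
  rw [evol, evol, ← lintegral_add_left hm]
  refine lintegral_mono fun θ => ?_
  by_cases h : loadAt t θ x = loadAt t θ y
  · rw [h]
    exact le_self_add
  · refine (hf _).trans (le_add_left ?_)
    exact_mod_cast one_le_l1Dist h

theorem evol_total_zero_le {t : ℝ} (ht : 0 ≤ t) :
    evol Λ d t (fun y => total y) (0 : Fin n → ℕ) ≤ ENNReal.ofReal Λ := by
  refine (evol_total_le ht 0).trans ?_
  have h0 : (total (0 : Fin n → ℕ)) = 0 := by simp [total]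
  rw [h0, Nat.cast_zero, mul_zero, zero_add]
  refine ENNReal.ofReal_le_ofReal ?_
  have hΛ : 0 < Λ := Fact.out
  have := Real.exp_pos (-t)
  nlinarith

/-- The error made by replacing the limit law by the law at time `t`, started from no balls. -/
def limitError (Λ t : ℝ) : ℝ≥0∞ := ENNReal.ofReal (Real.exp (-t)) * ENNReal.ofReal Λ

theorem tendsto_ofReal_exp_neg :
    Tendsto (fun m : ℕ => ENNReal.ofReal (Real.exp (-(m : ℝ)))) atTop (𝓝 0) := by
  have h := ENNReal.tendsto_ofReal
    ((Real.tendsto_exp_neg_atTop_nhds_zero).comp tendsto_natCast_atTop_atTop)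
  rw [ENNReal.ofReal_zero] at h
  exact h

theorem tendsto_limitError : Tendsto (fun m : ℕ => limitError Λ m) atTop (𝓝 0) := by
  have h := ENNReal.Tendsto.mul_const (b := ENNReal.ofReal Λ) tendsto_ofReal_exp_neg
    (.inr ENNReal.ofReal_ne_top)
  rwa [zero_mul] at h

/-- A one-sided Cauchy estimate: the state reached at time `s` has mean total at most `Λ`, and
running `t` longer from it or from the empty state makes little difference. -/
theorem evol_zero_le_add {s t : ℝ} (hs : 0 ≤ s) (ht : 0 ≤ t) {f : (Fin n → ℕ) → ℝ≥0∞}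
    (hf : ∀ x, f x ≤ 1) :
    evol Λ d t f 0 ≤ evol Λ d (s + t) f 0 + limitError Λ t := by
  rw [evol_add ht hs hf]
  have hm : Measurable fun θ : ℕ → Step d n => evol Λ d t f (loadAt s θ 0) :=
    (Measurable.of_discrete (f := evol Λ d t f)).comp (measurable_loadAt_noise s 0)
  have hm' : Measurable fun θ : ℕ → Step d n => (total (loadAt s θ 0) : ℝ≥0∞) :=
    (Measurable.of_discrete (f := fun y : Fin n → ℕ => (total y : ℝ≥0∞))).comp
      (measurable_loadAt_noise s 0)
  calc evol Λ d t f 0 = evol Λ d s (fun _ => evol Λ d t f 0) 0 := (evol_const _ _ _).symm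
    _ ≤ evol Λ d s (fun y => evol Λ d t f y + ENNReal.ofReal (Real.exp (-t)) * total y) 0 :=
        evol_mono s (fun y => by
          have := evol_le_evol_add (Λ := Λ) (d := d) ht hf 0 y
          rwa [l1Dist_comm, l1Dist_zero_right] at this) 0
    _ = evol Λ d s (evol Λ d t f) 0 +
          ENNReal.ofReal (Real.exp (-t)) * evol Λ d s (fun y => total y) 0 := by
        simp only [evol] at hm ⊢
        rw [lintegral_add_left hm, lintegral_const_mul _ hm']
    _ ≤ _ := by
        unfold limitError
        gcongr
        exact evol_total_zero_le hs

/-! ### The stationary distribution -/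

/-- The limiting expectation of `f`, started from no balls. -/
def limitMean (Λ : ℝ) (d : ℕ) [NeZero d] (f : (Fin n → ℕ) → ℝ≥0∞) : ℝ≥0∞ :=
  liminf (fun m : ℕ => evol Λ d m f 0) atTop

theorem evol_zero_le_limitMean {t : ℝ} (ht : 0 ≤ t) {f : (Fin n → ℕ) → ℝ≥0∞}
    (hf : ∀ x, f x ≤ 1) :
    evol Λ d t f 0 ≤ limitMean Λ d f + limitError Λ t := by
  rw [← tsub_le_iff_right]
  refine le_liminf_of_le (by isBoundedDefault) ?_
  filter_upwards [eventually_ge_atTop ⌈t⌉₊] with m hm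
  have hm : t ≤ m := Nat.ceil_le.1 hm
  have := evol_zero_le_add (Λ := Λ) (d := d) (sub_nonneg.2 hm) ht hf
  rw [sub_add_cancel] at this
  exact tsub_le_iff_right.2 this

/-- The indicator function of a load vector. -/
def point (x : Fin n → ℕ) : (Fin n → ℕ) → ℝ≥0∞ := Set.indicator {x} 1

theorem point_le_one (x y : Fin n → ℕ) : point x y ≤ 1 :=
  Set.indicator_le_self' (s := {x}) (f := (1 : (Fin n → ℕ) → ℝ≥0∞)) (fun _ _ => zero_le) y

theorem lintegral_point (μ : Measure (Fin n → ℕ)) (x : Fin n → ℕ) :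
    ∫⁻ y, point x y ∂μ = μ {x} :=
  lintegral_indicator_one (measurableSet_singleton x)

/-- The limit law of the load vector, started from no balls. -/
def limitLaw (Λ : ℝ) (d n : ℕ) [NeZero d] : Measure (Fin n → ℕ) :=
  Measure.count.withDensity fun x => limitMean Λ d (point x)

theorem limitLaw_singleton (x : Fin n → ℕ) : limitLaw Λ d n {x} = limitMean Λ d (point x) := by
  rw [limitLaw, withDensity_apply _ (measurableSet_singleton x), Measure.restrict_singleton]
  simp

theorem tsum_evol_point (t : ℝ) (f : (Fin n → ℕ) → ℝ≥0∞) (x : Fin n → ℕ) :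
    ∑' y, f y * evol Λ d t (point y) x = evol Λ d t f x := by
  have h := lintegral_lawAt (Λ := Λ) (d := d) t (Measure.dirac x) f
  rw [lintegral_dirac, lintegral_countable'] at h
  rw [← h]
  refine tsum_congr fun y => ?_
  rw [← lintegral_point, lintegral_lawAt, lintegral_dirac]

/-- Fatou's lemma for counting measure on load vectors. -/
theorem lintegral_limitLaw_le {f : (Fin n → ℕ) → ℝ≥0∞} (hf : ∀ x, f x ≠ ⊤) :
    ∫⁻ x, f x ∂(limitLaw Λ d n) ≤ limitMean Λ d f := by
  rw [limitLaw, lintegral_withDensity_eq_lintegral_mul _ Measurable.of_discrete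
    Measurable.of_discrete]
  have h : ∀ x, ((fun x : Fin n → ℕ => limitMean Λ d (point x)) * f) x =
      liminf (fun m : ℕ => f x * evol Λ d m (point x) 0) atTop := by
    intro x
    rw [ENNReal.liminf_const_mul_of_ne_top (hf x), Pi.mul_apply, mul_comm]
    rfl
  simp_rw [h]
  refine (lintegral_liminf_le fun m => Measurable.of_discrete).trans (le_of_eq ?_)
  simp_rw [lintegral_count, tsum_evol_point]
  rfl

theorem le_of_forall_le_add_limitError {a b : ℝ≥0∞} (C : ℝ≥0∞) (hC : C ≠ ⊤)
    (h : ∀ m : ℕ, a ≤ b + C * limitError Λ m) : a ≤ b := by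
  have ht := (ENNReal.Tendsto.const_mul (a := C) (tendsto_limitError (Λ := Λ)) (.inr hC)).const_add b
  rw [mul_zero, add_zero] at ht
  exact ge_of_tendsto' ht h

theorem lintegral_total_limitLaw_le :
    ∫⁻ x, total x ∂(limitLaw Λ d n) ≤ ENNReal.ofReal Λ :=
  (lintegral_limitLaw_le fun _ => ENNReal.natCast_ne_top _).trans
    (liminf_le_of_frequently_le' (Frequently.of_forall fun m =>
      evol_total_zero_le (Nat.cast_nonneg m)))

theorem finite_total_lt (M : ℕ) : {x : Fin n → ℕ | total x < M}.Finite := by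
  refine (Set.Finite.pi' fun _ : Fin n => Set.finite_lt_nat M).subset fun x hx j => ?_
  exact (Finset.single_le_sum (f := x) (fun _ _ => Nat.zero_le _) (Finset.mem_univ j)).trans_lt hx

instance isProbabilityMeasure_limitLaw : IsProbabilityMeasure (limitLaw Λ d n) := by
  refine ⟨le_antisymm ?_ ?_⟩
  · rw [← lintegral_one]
    refine (lintegral_limitLaw_le fun _ => ENNReal.one_ne_top).trans ?_
    exact liminf_le_of_frequently_le' (Frequently.of_forall fun m => (evol_const _ _ _).le)
  -- No mass escapes: at every time, by Markov's inequality, at most `Λ / (M + 1)` lies outside the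
  -- finite set where the total is at most `M`.
  · have key : ∀ M : ℕ, 1 ≤ limitLaw Λ d n Set.univ + ENNReal.ofReal Λ / (M + 1 : ℕ) := by
      intro M
      set A := (finite_total_lt (n := n) (M + 1)).toFinset with hA
      refine le_of_forall_le_add_limitError (Λ := Λ) A.card (ENNReal.natCast_ne_top _) fun m => ?_
      have hm : (0 : ℝ) ≤ m := Nat.cast_nonneg m
      have h1 : ∀ y : Fin n → ℕ, (1 : ℝ≥0∞) ≤ (∑ x ∈ A, point x y) +
          (total y : ℝ≥0∞) / (M + 1 : ℕ) := by
        intro y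
        by_cases hy : total y < M + 1
        · refine le_add_right ?_
          have hyA : y ∈ A := by simpa [hA] using hy
          refine le_trans ?_ (Finset.single_le_sum (f := fun x => point x y)
            (fun _ _ => zero_le) hyA)
          simp [point]
        · refine le_add_left ?_
          rw [ENNReal.le_div_iff_mul_le (.inl (by simp)) (.inl (ENNReal.natCast_ne_top _)), one_mul]
          exact_mod_cast not_lt.1 hy
      have hp : ∀ x, Measurable fun θ : ℕ → Step d n => point x (loadAt (m : ℝ) θ 0) := fun x =>
        (Measurable.of_discrete (f := point x)).comp (measurable_loadAt_noise _ 0)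
      have hT : Measurable fun θ : ℕ → Step d n => (total (loadAt (m : ℝ) θ 0) : ℝ≥0∞) :=
        (Measurable.of_discrete (f := fun y : Fin n → ℕ => (total y : ℝ≥0∞))).comp
          (measurable_loadAt_noise _ 0)
      calc (1 : ℝ≥0∞) = evol Λ d m (fun _ => 1) (0 : Fin n → ℕ) := (evol_const _ _ _).symm
        _ ≤ evol Λ d m (fun y => (∑ x ∈ A, point x y) + (total y : ℝ≥0∞) / (M + 1 : ℕ)) 0 :=
          evol_mono _ h1 0
        _ = ∑ x ∈ A, evol Λ d m (point x) 0 +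
            evol Λ d m (fun y => total y) (0 : Fin n → ℕ) / (M + 1 : ℕ) := by
          simp only [evol, div_eq_mul_inv]
          rw [lintegral_add_left (Finset.measurable_sum _ fun x _ => hp x),
            lintegral_finsetSum _ fun x _ => hp x, lintegral_mul_const _ hT]
        _ ≤ ∑ x ∈ A, (limitMean Λ d (point x) + limitError Λ m) +
            ENNReal.ofReal Λ / (M + 1 : ℕ) := by
          gcongr with x hx
          · exact evol_zero_le_limitMean hm (point_le_one x)
          · exact evol_total_zero_le hm
        _ = limitLaw Λ d n A + A.card * limitError Λ m + ENNReal.ofReal Λ / (M + 1 : ℕ) := by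
          rw [Finset.sum_add_distrib, Finset.sum_const, nsmul_eq_mul,
            ← sum_measure_singleton]
          simp only [limitLaw_singleton]
        _ ≤ _ := by
          rw [add_right_comm]
          gcongr
          exact Set.subset_univ _
    have ht : Tendsto (fun M : ℕ => limitLaw Λ d n Set.univ + ENNReal.ofReal Λ / (M + 1 : ℕ))
        atTop (𝓝 (limitLaw Λ d n Set.univ + 0)) := by
      refine Tendsto.const_add _ ?_
      have := (ENNReal.Tendsto.const_div (a := ENNReal.ofReal Λ) ENNReal.tendsto_nat_nhds_top
        (.inr ENNReal.ofReal_ne_top)).comp (tendsto_add_atTop_nat 1)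
      simpa [Function.comp_def] using this
    rw [add_zero] at ht
    exact ge_of_tendsto' ht key

theorem measure_le_of_singleton_le {μ ν : Measure (Fin n → ℕ)} (h : ∀ x, μ {x} ≤ ν {x}) :
    μ ≤ ν := by
  refine Measure.le_iff.2 fun s hs => ?_
  rw [← lintegral_indicator_one hs, ← lintegral_indicator_one hs, lintegral_countable',
    lintegral_countable']
  exact ENNReal.tsum_le_tsum fun x => mul_le_mul' le_rfl (h x)

/-- Between probability measures one inequality suffices, and Fatou's lemma gives it: the masses at
times `m + t` are bounded by the limiting ones up to a vanishing error. -/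
theorem lawAt_limitLaw {t : ℝ} (ht : 0 ≤ t) :
    lawAt Λ d t (limitLaw Λ d n) = limitLaw Λ d n := by
  refine Measure.eq_of_le_of_isProbabilityMeasure (measure_le_of_singleton_le fun x => ?_)
  rw [← lintegral_point, lintegral_lawAt, limitLaw_singleton]
  refine (lintegral_limitLaw_le fun y => ((evol_le_one t (point_le_one x) y).trans_lt
    ENNReal.one_lt_top).ne).trans ?_
  refine le_of_forall_le_add_limitError (Λ := Λ) 1 ENNReal.one_ne_top fun k => ?_
  refine liminf_le_of_frequently_le' (Eventually.frequently ?_)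
  filter_upwards [eventually_ge_atTop k] with m hm
  have hkm : (k : ℝ) ≤ m := Nat.cast_le.2 hm
  have hk : (0 : ℝ) ≤ k := Nat.cast_nonneg k
  rw [← evol_add ht (hk.trans hkm) (point_le_one x), one_mul]
  refine (evol_zero_le_limitMean (by linarith) (point_le_one x)).trans ?_
  unfold limitError
  gcongr
  linarith

/-- Stationary distributions are comparable, whether or not they have finite mean. -/
theorem measure_le_of_stationary {μ ν : Measure (Fin n → ℕ)} [IsProbabilityMeasure μ]
    [IsProbabilityMeasure ν] (hμ : ∀ t, 0 ≤ t → lawAt Λ d t μ = μ)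
    (hν : ∀ t, 0 ≤ t → lawAt Λ d t ν = ν) : μ ≤ ν := by
  refine measure_le_of_singleton_le fun x => ?_
  -- The cap at `1` allows dominated convergence under any probability measure, so no moment
  -- assumption is needed.
  set e : ℕ → (Fin n → ℕ) → ℝ≥0∞ :=
    fun m y => min 1 (ENNReal.ofReal (Real.exp (-(m : ℝ))) * total y) with he
  have hlim : ∀ (π : Measure (Fin n → ℕ)) [IsProbabilityMeasure π],
      Tendsto (fun m => ∫⁻ y, e m y ∂π) atTop (𝓝 0) := by
    intro π _
    have h := tendsto_lintegral_of_dominated_convergence (μ := π) (F := e) (f := fun _ => 0)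
      (fun _ => 1) (fun m => Measurable.of_discrete)
      (fun m => .of_forall fun y => min_le_left _ _) (by simp) (.of_forall fun y => ?_)
    · simpa using h
    · have h1 := (ENNReal.Tendsto.mul_const (b := (total y : ℝ≥0∞)) tendsto_ofReal_exp_neg
        (.inr (ENNReal.natCast_ne_top _)))
      rw [zero_mul] at h1
      exact tendsto_of_tendsto_of_tendsto_of_le_of_le tendsto_const_nhds h1 (fun _ => zero_le)
        fun m => min_le_right _ _
  -- Both laws are compared with the empty start. As one vector is zero, `y + z` is the other, and
  -- its total is their distance.
  have hle : ∀ (m : ℕ) (y z : Fin n → ℕ), z = 0 ∨ y = 0 → evol Λ d m (point x) y ≤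
      evol Λ d m (point x) z + e m (y + z) := by
    intro m y z hz
    have hd : l1Dist y z = total (y + z) := by
      rcases hz with rfl | rfl
      · rw [l1Dist_zero_right, add_zero]
      · rw [l1Dist_comm, l1Dist_zero_right, zero_add]
    rw [he, ← min_add_add_left]
    refine le_min (le_add_left (evol_le_one _ (point_le_one x) y)) ?_
    rw [← hd]
    exact evol_le_evol_add (Nat.cast_nonneg m) (point_le_one x) y z
  have key : ∀ m : ℕ, μ {x} ≤ ν {x} + (∫⁻ y, e m y ∂ν + ∫⁻ y, e m y ∂μ) := by
    intro m
    have hm : (0 : ℝ) ≤ m := Nat.cast_nonneg m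
    have h1 : μ {x} ≤ evol Λ d m (point x) 0 + ∫⁻ y, e m y ∂μ := by
      conv_lhs => rw [← hμ m hm, ← lintegral_point, lintegral_lawAt]
      refine (lintegral_mono fun y => hle m y 0 (.inl rfl)).trans_eq ?_
      rw [lintegral_add_left measurable_const]
      simp
    have h2 : evol Λ d m (point x) 0 ≤ ν {x} + ∫⁻ y, e m y ∂ν := by
      conv_rhs => rw [← hν m hm, ← lintegral_point, lintegral_lawAt, hν m hm]
      rw [← lintegral_add_left Measurable.of_discrete]
      calc evol Λ d m (point x) 0 = ∫⁻ _, evol Λ d m (point x) 0 ∂ν := by simp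
        _ ≤ _ := lintegral_mono fun y => by simpa using hle m 0 y (.inr rfl)
    rw [← add_assoc]
    exact h1.trans (add_le_add_left h2 _)
  have ht := ((hlim ν).add (hlim μ)).const_add (ν {x})
  rw [add_zero, add_zero] at ht
  exact ge_of_tendsto' ht key

/-! ### Distances to the stationary distribution -/

theorem dTV_le_dW (μ ν : Measure (Fin n → ℕ)) : dTV μ ν ≤ dW μ ν := by
  refine iInf₂_mono fun γ _ => ?_
  have hm : MeasurableSet {z : (Fin n → ℕ) × (Fin n → ℕ) | z.1 ≠ z.2} := .of_discrete
  rw [← lintegral_indicator_one hm]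
  refine lintegral_mono fun z => ?_
  by_cases h : z.1 = z.2
  · simp [h]
  · rw [Set.indicator_of_mem (show z ∈ {z : (Fin n → ℕ) × (Fin n → ℕ) | z.1 ≠ z.2} from h)]
    exact Nat.one_le_cast.2 (one_le_l1Dist h)

/-- The coupling takes independent initial states and common noise; the initial distance is at most
the sum of the totals. -/
theorem dW_lawAt_le {t : ℝ} (ht : 0 ≤ t) (μ ν : Measure (Fin n → ℕ)) [IsProbabilityMeasure μ]
    [IsProbabilityMeasure ν] :
    dW (lawAt Λ d t μ) (lawAt Λ d t ν) ≤
      ENNReal.ofReal (Real.exp (-t)) * (∫⁻ x, total x ∂μ + ∫⁻ x, total x ∂ν) := by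
  have h1 : Measurable fun p : ((Fin n → ℕ) × (Fin n → ℕ)) × (ℕ → Step d n) => loadAt t p.2 p.1.1 :=
    (measurable_loadAt_swap t).comp
      (f := fun p : ((Fin n → ℕ) × (Fin n → ℕ)) × (ℕ → Step d n) => (p.1.1, p.2)) (by fun_prop)
  have h2 : Measurable fun p : ((Fin n → ℕ) × (Fin n → ℕ)) × (ℕ → Step d n) => loadAt t p.2 p.1.2 :=
    (measurable_loadAt_swap t).comp
      (f := fun p : ((Fin n → ℕ) × (Fin n → ℕ)) × (ℕ → Step d n) => (p.1.2, p.2)) (by fun_prop)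
  have hd : Measurable fun p : ((Fin n → ℕ) × (Fin n → ℕ)) × (ℕ → Step d n) =>
      (l1Dist (loadAt t p.2 p.1.1) (loadAt t p.2 p.1.2) : ℝ≥0∞) := measurable_l1Dist_cast h1 h2
  have hγ : IsCoupling (lawAt Λ d t μ) (lawAt Λ d t ν) (((μ.prod ν).prod (noiseLaw Λ d n)).map
      fun p => (loadAt t p.2 p.1.1, loadAt t p.2 p.1.2)) := by
    constructor
    · rw [Measure.map_map measurable_fst (h1.prodMk h2), lawAt]
      have : (μ.prod (noiseLaw Λ d n)) = ((μ.prod ν).prod (noiseLaw Λ d n)).map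
          (Prod.map Prod.fst id) := by
        rw [← Measure.map_prod_map _ _ measurable_fst measurable_id, Measure.map_fst_prod]
        simp
      rw [this, Measure.map_map (measurable_loadAt_swap t) (by fun_prop)]
      rfl
    · rw [Measure.map_map measurable_snd (h1.prodMk h2), lawAt]
      have : (ν.prod (noiseLaw Λ d n)) = ((μ.prod ν).prod (noiseLaw Λ d n)).map
          (Prod.map Prod.snd id) := by
        rw [← Measure.map_prod_map _ _ measurable_snd measurable_id, Measure.map_snd_prod]
        simp
      rw [this, Measure.map_map (measurable_loadAt_swap t) (by fun_prop)]
      rfl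
  have hT : Measurable fun x : Fin n → ℕ => (total x : ℝ≥0∞) := Measurable.of_discrete
  have hT1 : Measurable fun z : (Fin n → ℕ) × (Fin n → ℕ) => (total z.1 : ℝ≥0∞) :=
    hT.comp measurable_fst
  have hT2 : Measurable fun z : (Fin n → ℕ) × (Fin n → ℕ) => (total z.2 : ℝ≥0∞) :=
    hT.comp measurable_snd
  have hle : ∀ z : (Fin n → ℕ) × (Fin n → ℕ),
      ∫⁻ θ, (l1Dist (loadAt t θ z.1) (loadAt t θ z.2) : ℝ≥0∞) ∂(noiseLaw Λ d n) ≤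
        ENNReal.ofReal (Real.exp (-t)) * ((total z.1 : ℝ≥0∞) + total z.2) := by
    intro z
    refine (lintegral_l1Dist_loadAt_le ht z.1 z.2).trans ?_
    gcongr
    exact_mod_cast l1Dist_le z.1 z.2
  refine (iInf₂_le _ hγ).trans ?_
  rw [lintegral_map (measurable_l1Dist_cast measurable_fst measurable_snd) (h1.prodMk h2),
    lintegral_prod _ hd.aemeasurable]
  refine (lintegral_mono hle).trans_eq ?_
  have hT12 : Measurable fun z : (Fin n → ℕ) × (Fin n → ℕ) =>
      (total z.1 : ℝ≥0∞) + total z.2 := hT1.add hT2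
  have e1 := (measurePreserving_fst (μ := μ) (ν := ν)).lintegral_comp hT
  have e2 := (measurePreserving_snd (μ := μ) (ν := ν)).lintegral_comp hT
  rw [lintegral_const_mul _ hT12, lintegral_add_left hT1, e1, e2]

end BallsBins

end

theorem theorem1p1 (lam : ℝ) (hlam : 0 < lam) (d n : ℕ) [NeZero d] [NeZero n] :
    ∃ ρ : Measure (Fin n → ℕ),
      BallsBins.IsStationary lam d n ρ ∧
      (∀ ρ' : Measure (Fin n → ℕ), BallsBins.IsStationary lam d n ρ' → ρ' = ρ) ∧
      ∀ {Ω : Type*} [MeasurableSpace Ω] (P : Measure Ω) [IsProbabilityMeasure P]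
        (X : ℝ → Ω → Fin n → ℕ), BallsBins.IsLoadProcess lam d n P X →
        Integrable (fun ω => (BallsBins.total (X 0 ω) : ℝ)) P →
        ∀ t : ℝ, 0 ≤ t →
          BallsBins.dTV (P.map (X t)) ρ ≤ BallsBins.dW (P.map (X t)) ρ ∧
          BallsBins.dW (P.map (X t)) ρ ≤
            ENNReal.ofReal ((lam * n + ∫ ω, (BallsBins.total (X 0 ω) : ℝ) ∂P) * Real.exp (-t)) := by
  have hpos : 0 < lam * n := mul_pos hlam (Nat.cast_pos.2 (Nat.pos_of_ne_zero (NeZero.ne n)))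
  have : Fact (0 < lam * n) := ⟨hpos⟩
  have hρ : ∀ t, 0 ≤ t → BallsBins.lawAt (lam * n) d t (BallsBins.limitLaw (lam * n) d n) =
      BallsBins.limitLaw (lam * n) d n := fun t ht => BallsBins.lawAt_limitLaw ht
  refine ⟨BallsBins.limitLaw (lam * n) d n, BallsBins.isStationary_iff.2 ⟨inferInstance, hρ⟩,
    fun ρ' h' => ?_, fun P _ X hX hint t ht => ⟨BallsBins.dTV_le_dW _ _, ?_⟩⟩
  · obtain ⟨hp, h'⟩ := BallsBins.isStationary_iff.1 h'
    exact Measure.eq_of_le_of_isProbabilityMeasure (BallsBins.measure_le_of_stationary h' hρ)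
  · obtain ⟨U, hU, hUX⟩ := hX
    -- Otherwise `P.map (X 0)` is zero by convention, hence so is the input law, which cannot be the
    -- law of `U` under a probability measure.
    have hX0 : AEMeasurable (X 0) P := by
      by_contra h
      have h0 : BallsBins.inputLaw lam d n (P.map (X 0)) = 0 := by
        rw [Measure.map_of_not_aemeasurable h, BallsBins.inputLaw, Measure.zero_prod]
      have h1 := hU.map_eq
      rw [h0, Measure.map_eq_zero_iff hU.aemeasurable] at h1
      exact IsProbabilityMeasure.ne_zero P h1
    have : IsProbabilityMeasure (P.map (X 0)) := Measure.isProbabilityMeasure_map hX0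
    have hXt : P.map (X t) = BallsBins.lawAt (lam * n) d t (P.map (X 0)) :=
      (((BallsBins.hasLaw_load t (P.map (X 0))).comp hU).congr
        (hUX.mono fun ω h => h t ht)).map_eq
    have hmean : ∫⁻ x, (BallsBins.total x : ENNReal) ∂(P.map (X 0)) =
        ENNReal.ofReal (∫ ω, (BallsBins.total (X 0 ω) : ℝ) ∂P) := by
      rw [lintegral_map' Measurable.of_discrete.aemeasurable hX0,
        ofReal_integral_eq_lintegral_ofReal hint (.of_forall fun ω => Nat.cast_nonneg _)]
      simp
    rw [hXt]
    -- By stationarity the limit law is its own law at time `t`, so both arguments become laws at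
    -- time `t`.
    conv_lhs => rw [← hρ t ht]
    refine (BallsBins.dW_lawAt_le ht _ _).trans ?_
    rw [hmean, mul_comm, ENNReal.ofReal_mul (add_nonneg hpos.le (integral_nonneg fun _ =>
      Nat.cast_nonneg _)), ENNReal.ofReal_add hpos.le (integral_nonneg fun _ => Nat.cast_nonneg _),
      add_comm]
    gcongr
    exact BallsBins.lintegral_total_limitLaw_le
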